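/- Let $K$ be a field of characteristic $0$, let $L$ be the free Lie algebra over $K$ generated by $X,Y$, graded by $\deg X=\deg Y=1$ and $\deg[A,B]=\deg A+\deg B$, and let $\bar L=L/[[L,L],[L,L]]$ with the induced grading. Let $\hat L$ and $\widehat{\bar L}$ be the graded completions (the Lie algebras of infinite series $\sum_n A_n$ with $A_n$ homogeneous of degree $n$). Write $[X^kY^lXY]=(\mathrm{ad}\,X)^k(\mathrm{ad}\,Y)^l[X,Y]$. Then: 1. The Hausdorff series $H=\ln(e^Xe^Y)$, computed in the algebra of non-commutative formal power series in $X,Y$ over $K$, is the image of exactly one element of $\hat L$ (again denoted $H$) under the canonical map $\hat L\to K\langle\langle X,Y\rangle\rangle$ that fixes $X,Y$ and turns brackets into commutators. 2. The elements $X$, $Y$, $[X^kY^lXY]$ ($k,l\ge 0$) form a linear basis of $\bar L$. 3. In the field of fractions of the ring $K[[x,y]]$ of commutative power series, the element $$h(x,y)=\frac1y\left(1-\frac{e^x-1}{x}\cdot\frac{x+y}{e^{x+y}-1}\right)$$ is a genuine power series $h=\sum_{k,l\ge0}h_{kl}x^ky^l\in K[[x,y]]$, and the image of $H$ under $\hat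 L\to\widehat{\bar L}$ is $$\bar H=X+Y+h(\mathrm{ad}\,X,\mathrm{ad}\,Y)[X,Y]=X+Y+\sum_{k,l\ge0}h_{kl}\,[X^kY^lXY].$$ -/

import Mathlib

namespace MetabelianBCH

/-! ### Graded completions of Lie algebras

A Lie algebra `M` with generators `g i` is graded by giving every generator degree `1` and
every bracket `⁅a, b⁆` the degree `deg a + deg b`. -/

section Completion

/-- `IsLieMonomial g n a`: the element `a` is an iterated bracket (with any bracketing)
of `n` of the generators `g i`. -/
inductive IsLieMonomial {M ι : Type*} [LieRing M] (g : ι → M) : ℕ → M → Prop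
  | gen (i : ι) : IsLieMonomial g 1 (g i)
  | bracket {m n : ℕ} {a b : M} (ha : IsLieMonomial g m a) (hb : IsLieMonomial g n b) :
      IsLieMonomial g (m + n) ⁅a, b⁆

/-- The homogeneous component of degree `n`. -/
def degreePiece (K : Type*) {M ι : Type*} [CommRing K] [LieRing M] [LieAlgebra K M]
    (g : ι → M) (n : ℕ) : Submodule K M :=
  Submodule.span K {a | IsLieMonomial g n a}

/-- Formal series `∑ n, f_n` of elements of `M`, where `f_n` is the term of index `n`. -/
def LieSeries (M : Type*) : Type _ := ℕ → M

namespace LieSeries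

/-- The formal series with terms `f n`. -/
def mk {M : Type*} (f : ℕ → M) : LieSeries M := f

/-- The term of index `n` of a formal series. -/
def coeff {M : Type*} (n : ℕ) (f : LieSeries M) : M := f n

theorem coeff_mk {M : Type*} (n : ℕ) (f : ℕ → M) : coeff n (mk f) = f n := rfl

@[ext]
theorem ext {M : Type*} {f g : LieSeries M} (h : ∀ n, coeff n f = coeff n g) : f = g :=
  funext h

instance {M : Type*} [AddCommGroup M] : AddCommGroup (LieSeries M) :=
  inferInstanceAs (AddCommGroup (ℕ → M))

instance {K M : Type*} [CommRing K] [AddCommGroup M] [Module K M] : Module K (LieSeries M) :=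
  inferInstanceAs (Module K (ℕ → M))

instance {M : Type*} [LieRing M] : Bracket (LieSeries M) (LieSeries M) where
  bracket f g := mk fun n =>
    ∑ p ∈ Finset.HasAntidiagonal.antidiagonal n, ⁅coeff p.1 f, coeff p.2 g⁆

theorem coeff_lie {M : Type*} [LieRing M] (n : ℕ) (f g : LieSeries M) :
    coeff n ⁅f, g⁆ =
      ∑ p ∈ Finset.HasAntidiagonal.antidiagonal n, ⁅coeff p.1 f, coeff p.2 g⁆ := rfl

theorem coeff_zero {M : Type*} [AddCommGroup M] (n : ℕ) : coeff n (0 : LieSeries M) = 0 := rfl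

theorem coeff_add {M : Type*} [AddCommGroup M] (n : ℕ) (f g : LieSeries M) :
    coeff n (f + g) = coeff n f + coeff n g := rfl

theorem coeff_smul {K M : Type*} [CommRing K] [AddCommGroup M] [Module K M] (n : ℕ) (c : K)
    (f : LieSeries M) : coeff n (c • f) = c • coeff n f := rfl

/-- The bracket of two series is the Cauchy product with respect to the bracket of `M`. -/
instance {M : Type*} [LieRing M] : LieRing (LieSeries M) where
  add_lie f g h := by
    ext n
    simp only [coeff_lie, coeff_add, add_lie, Finset.sum_add_distrib]
  lie_add f g h := by
    ext n
    simp only [coeff_lie, coeff_add, lie_add, Finset.sum_add_distrib]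
  lie_self f := by
    ext n
    rw [coeff_lie, coeff_zero]
    refine Finset.sum_involution (fun p _ => p.swap) ?_ ?_ ?_ ?_
    · intro p _
      simp only [Prod.fst_swap, Prod.snd_swap]
      rw [← lie_skew, neg_add_cancel]
    · rintro ⟨i, j⟩ _ hne heq
      simp only [Prod.swap_prod_mk, Prod.mk.injEq] at heq
      obtain ⟨rfl, -⟩ := heq
      simp at hne
    · intro p hp
      simpa [add_comm] using hp
    · intro p _
      simp
  leibniz_lie f g h := by
    ext n
    simp only [coeff_lie, coeff_add, lie_sum, sum_lie]
    rw [Finset.sum_congr rfl fun p _ => Finset.sum_congr rfl fun q _ =>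
      leibniz_lie (coeff p.1 f) (coeff q.1 g) (coeff q.2 h)]
    simp only [Finset.sum_add_distrib]
    rw [Finset.sum_sigma', Finset.sum_sigma', Finset.sum_sigma', Finset.sum_sigma']
    congr 1
    · refine Finset.sum_nbij' (fun a => ⟨(a.1.1 + a.2.1, a.2.2), (a.1.1, a.2.1)⟩)
        (fun a => ⟨(a.2.1, a.2.2 + a.1.2), (a.2.2, a.1.2)⟩) ?_ ?_ ?_ ?_ ?_
      all_goals
        rintro ⟨⟨i, j⟩, ⟨k, l⟩⟩ ha
        simp only [Finset.mem_sigma, Finset.HasAntidiagonal.mem_antidiagonal] at ha ⊢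
        try grind
    · refine Finset.sum_nbij' (fun a => ⟨(a.2.1, a.1.1 + a.2.2), (a.1.1, a.2.2)⟩)
        (fun a => ⟨(a.2.1, a.1.1 + a.2.2), (a.1.1, a.2.2)⟩) ?_ ?_ ?_ ?_ ?_
      all_goals
        rintro ⟨⟨i, j⟩, ⟨k, l⟩⟩ ha
        simp only [Finset.mem_sigma, Finset.HasAntidiagonal.mem_antidiagonal] at ha ⊢
        try grind

instance {K M : Type*} [CommRing K] [LieRing M] [LieAlgebra K M] :
    LieAlgebra K (LieSeries M) where
  lie_smul c f g := by
    ext n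
    simp only [coeff_lie, coeff_smul, lie_smul, Finset.smul_sum]

end LieSeries

/-- The graded completion: the Lie algebra of infinite series `∑ n, f_n` with `f_n`
homogeneous of degree `n`. -/
def gradedCompletion (K : Type*) {M ι : Type*} [CommRing K] [LieRing M] [LieAlgebra K M]
    (g : ι → M) : LieSubalgebra K (LieSeries M) where
  carrier := {f | ∀ n, LieSeries.coeff n f ∈ degreePiece K g n}
  add_mem' hf hg n := (degreePiece K g n).add_mem (hf n) (hg n)
  zero_mem' n := (degreePiece K g n).zero_mem
  smul_mem' c _ hf n := (degreePiece K g n).smul_mem c (hf n)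
  lie_mem' := by
    intro f h hf hh n
    rw [LieSeries.coeff_lie]
    refine Submodule.sum_mem _ fun p hp => ?_
    obtain rfl := Finset.HasAntidiagonal.mem_antidiagonal.mp hp
    refine Submodule.span_induction₂
      (p := fun a b _ _ => ⁅a, b⁆ ∈ degreePiece K g (p.1 + p.2))
      (fun a b ha hb => Submodule.subset_span (IsLieMonomial.bracket ha hb))
      ?_ ?_ ?_ ?_ ?_ ?_ (hf p.1) (hh p.2)
    · intro b _
      simp
    · intro a _
      simp
    · intro a b c _ _ _ h₁ h₂
      rw [add_lie]
      exact Submodule.add_mem _ h₁ h₂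
    · intro a b c _ _ _ h₁ h₂
      rw [lie_add]
      exact Submodule.add_mem _ h₁ h₂
    · intro r a b _ _ h₁
      rw [smul_lie]
      exact Submodule.smul_mem _ _ h₁
    · intro r a b _ _ h₁
      rw [lie_smul]
      exact Submodule.smul_mem _ _ h₁

/-- The generator `g i`, as an element of the graded completion (concentrated in degree `1`). -/
def gen (K : Type*) {M ι : Type*} [CommRing K] [LieRing M] [LieAlgebra K M]
    (g : ι → M) (i : ι) : gradedCompletion K g :=
  ⟨LieSeries.mk fun n => if n = 1 then g i else 0, by
    intro n
    rw [LieSeries.coeff_mk]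
    split_ifs with hn
    · subst hn
      exact Submodule.subset_span (IsLieMonomial.gen i)
    · exact Submodule.zero_mem _⟩

theorem map_mem_degreePiece {K M M' ι : Type*} [CommRing K] [LieRing M] [LieAlgebra K M]
    [LieRing M'] [LieAlgebra K M'] (φ : M →ₗ⁅K⁆ M') (g : ι → M) {n : ℕ} {a : M}
    (ha : a ∈ degreePiece K g n) : φ a ∈ degreePiece K (fun i => φ (g i)) n := by
  have key : ∀ {m : ℕ} {b : M}, IsLieMonomial g m b →
      IsLieMonomial (fun i => φ (g i)) m (φ b) := by
    intro m b hb
    induction hb with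
    | gen i => exact IsLieMonomial.gen (g := fun i => φ (g i)) i
    | bracket _ _ h₁ h₂ =>
      rw [LieHom.map_lie]
      exact IsLieMonomial.bracket h₁ h₂
  refine Submodule.span_induction (p := fun b _ => φ b ∈ degreePiece K (fun i => φ (g i)) n)
    (fun b hb => Submodule.subset_span (key hb)) ?_ ?_ ?_ ha
  · simp
  · intro b c _ _ h₁ h₂
    rw [map_add]
    exact Submodule.add_mem _ h₁ h₂
  · intro r b _ h₁
    rw [map_smul]
    exact Submodule.smul_mem _ _ h₁

/-- The homomorphism of graded completions induced, degree by degree, by a homomorphism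
of Lie algebras that sends the generators to the generators. -/
def completionMap {K M M' ι : Type*} [CommRing K] [LieRing M] [LieAlgebra K M]
    [LieRing M'] [LieAlgebra K M'] (φ : M →ₗ⁅K⁆ M') (g : ι → M) :
    gradedCompletion K g →ₗ⁅K⁆ gradedCompletion K (fun i => φ (g i)) where
  toFun f := ⟨LieSeries.mk fun n => φ (LieSeries.coeff n f.1),
    fun n => map_mem_degreePiece φ g (f.2 n)⟩
  map_add' f h := Subtype.ext <| LieSeries.ext fun n =>
    map_add φ (LieSeries.coeff n f.1) (LieSeries.coeff n h.1)
  map_smul' c f := Subtype.ext <| LieSeries.ext fun n =>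
    map_smul φ c (LieSeries.coeff n f.1)
  map_lie' := by
    intro f h
    refine Subtype.ext (LieSeries.ext fun n => ?_)
    change φ (LieSeries.coeff n ⁅f.1, h.1⁆) = ∑ p ∈ Finset.HasAntidiagonal.antidiagonal n,
      ⁅φ (LieSeries.coeff p.1 f.1), φ (LieSeries.coeff p.2 h.1)⁆
    simp only [LieSeries.coeff_lie, map_sum, LieHom.map_lie]

/-- The operator `(ad X)^k (ad Y)^l` on the graded completion, where `X = g 0`, `Y = g 1`. -/
def adMonomial {K M : Type*} [CommRing K] [LieRing M] [LieAlgebra K M] (g : Fin 2 → M)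
    (k l : ℕ) (A : gradedCompletion K g) : gradedCompletion K g :=
  (LieAlgebra.ad K (gradedCompletion K g) (gen K g 0) ^ k)
    ((LieAlgebra.ad K (gradedCompletion K g) (gen K g 1) ^ l) A)

/-- The operator `h(ad X, ad Y) = ∑ k l, h_kl (ad X)^k (ad Y)^l` on the graded completion, where
`X = g 0`, `Y = g 1`. The operator `(ad X)^k (ad Y)^l` raises degrees by `k + l`, so only the
terms with `k + l ≤ n` contribute in degree `n`. -/
noncomputable def adSeries {K M : Type*} [CommRing K] [LieRing M] [LieAlgebra K M] (g : Fin 2 → M)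
    (h : MvPowerSeries (Fin 2) K) (A : gradedCompletion K g) : gradedCompletion K g :=
  ⟨LieSeries.mk fun n =>
      ∑ d ∈ Finset.range (n + 1), ∑ p ∈ Finset.HasAntidiagonal.antidiagonal d,
        MvPowerSeries.coeff (Finsupp.single 0 p.1 + Finsupp.single 1 p.2) h •
          LieSeries.coeff n (adMonomial g p.1 p.2 A).1, by
    intro n
    rw [LieSeries.coeff_mk]
    exact Submodule.sum_mem _ fun d _ => Submodule.sum_mem _ fun p _ =>
      Submodule.smul_mem _ _ ((adMonomial g p.1 p.2 A).2 n)⟩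

end Completion

/-! ### The completed free associative algebra and the Hausdorff series -/

section Associative

/-- The homogeneous component of degree `n` of the free associative algebra on the set `ι`:
the span of the products of `n` generators. -/
def wordPiece (K ι : Type*) [CommRing K] (n : ℕ) : Submodule K (FreeAlgebra K ι) :=
  Submodule.span K (Set.range (FreeAlgebra.ι K : ι → FreeAlgebra K ι)) ^ n

/-- The algebra of non-commutative formal power series in the variables `ι`: the series
`∑ n, P n` with `P n` homogeneous of degree `n`, with the Cauchy product. (The index `n` is
recorded by a power of an auxiliary central variable.) -/
def ncSeries (K ι : Type*) [CommRing K] : Subalgebra K (PowerSeries (FreeAlgebra K ι)) where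
  carrier := {P | ∀ n, PowerSeries.coeff n P ∈ wordPiece K ι n}
  add_mem' := by
    intro P Q hP hQ n
    rw [map_add]
    exact Submodule.add_mem _ (hP n) (hQ n)
  mul_mem' := by
    intro P Q hP hQ n
    rw [PowerSeries.coeff_mul]
    refine Submodule.sum_mem _ fun p hp => ?_
    obtain rfl := Finset.HasAntidiagonal.mem_antidiagonal.mp hp
    rw [wordPiece, pow_add]
    exact Submodule.mul_mem_mul (hP p.1) (hQ p.2)
  algebraMap_mem' := by
    intro c n
    rw [PowerSeries.algebraMap_apply, PowerSeries.coeff_C]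
    split_ifs with hn
    · subst hn
      rw [wordPiece, pow_zero]
      exact Submodule.algebraMap_mem c
    · exact Submodule.zero_mem _

/-- The variable `X_i` as a non-commutative power series. -/
noncomputable def ncVar (K : Type*) {ι : Type*} [CommRing K] (i : ι) : ncSeries K ι :=
  ⟨PowerSeries.monomial 1 (FreeAlgebra.ι K i), by
    intro n
    rw [PowerSeries.coeff_monomial]
    split_ifs with hn
    · subst hn
      rw [wordPiece, pow_one]
      exact Submodule.subset_span ⟨i, rfl⟩
    · exact Submodule.zero_mem _⟩

/-- Substitution `F(P) = ∑ m, F_m P^m` of a non-commutative power series `P` with zero constant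
term into a power series `F` in one variable. The terms of `P^m` have degree at least `m`, so
only `m ≤ n` contributes in degree `n`. -/
noncomputable def ncSubst {K ι : Type*} [CommRing K] (F : PowerSeries K) (P : ncSeries K ι) :
    ncSeries K ι :=
  ⟨PowerSeries.mk fun n => ∑ m ∈ Finset.range (n + 1),
      PowerSeries.coeff m F • PowerSeries.coeff n (P ^ m).1, by
    intro n
    rw [PowerSeries.coeff_mk]
    exact Submodule.sum_mem _ fun m _ => Submodule.smul_mem _ _ ((P ^ m).2 n)⟩

/-- `e^P = ∑ P^m / m!`, for `P` with zero constant term. -/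
noncomputable def ncExp {K ι : Type*} [Field K] [CharZero K] (P : ncSeries K ι) : ncSeries K ι :=
  ncSubst (PowerSeries.exp K) P

/-- `ln P = ∑_{m ≥ 1} (-1)^(m-1) (P - 1)^m / m`, for `P` with constant term `1`. -/
noncomputable def ncLog {K ι : Type*} [Field K] [CharZero K] (P : ncSeries K ι) : ncSeries K ι :=
  ncSubst (PowerSeries.log K) (P - 1)

/-- The Hausdorff series `ln(e^X e^Y)` in the variables `X = X_0` and `Y = X_1`. -/
noncomputable def hausdorff (K : Type*) [Field K] [CharZero K] : ncSeries K (Fin 2) :=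
  ncLog (ncExp (ncVar K 0) * ncExp (ncVar K 1))

end Associative

/-! ### The free Lie algebra and the free metabelian Lie algebra on two generators -/

section Free

attribute [local instance] LieRing.ofAssociativeRing in
/-- The canonical homomorphism from the free Lie algebra to the free associative algebra; it is
the identity on generators and sends brackets to commutators. -/
noncomputable def freeLieToAssoc (K ι : Type*) [CommRing K] :
    FreeLieAlgebra K ι →ₗ[K] FreeAlgebra K ι :=
  (FreeLieAlgebra.lift K (FreeAlgebra.ι K : ι → FreeAlgebra K ι)).toLinearMap

attribute [local instance] LieRing.ofAssociativeRing in
theorem freeLieToAssoc_mem {K ι : Type*} [CommRing K] {n : ℕ} {a : FreeLieAlgebra K ι}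
    (ha : a ∈ degreePiece K (FreeLieAlgebra.of K) n) :
    freeLieToAssoc K ι a ∈ wordPiece K ι n := by
  have key : ∀ {m : ℕ} {b : FreeLieAlgebra K ι}, IsLieMonomial (FreeLieAlgebra.of K) m b →
      freeLieToAssoc K ι b ∈ wordPiece K ι m := by
    intro m b hb
    induction hb with
    | gen i =>
      have h : freeLieToAssoc K ι (FreeLieAlgebra.of K i) = FreeAlgebra.ι K i :=
        FreeLieAlgebra.lift_of_apply _ i
      rw [h, wordPiece, pow_one]
      exact Submodule.subset_span ⟨i, rfl⟩
    | @bracket p q a b _ _ h₁ h₂ =>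
      have h : freeLieToAssoc K ι ⁅a, b⁆ = freeLieToAssoc K ι a * freeLieToAssoc K ι b
          - freeLieToAssoc K ι b * freeLieToAssoc K ι a :=
        LieHom.map_lie (FreeLieAlgebra.lift K (FreeAlgebra.ι K : ι → FreeAlgebra K ι)) a b
      rw [h]
      refine Submodule.sub_mem _ ?_ ?_
      · rw [wordPiece, pow_add]
        exact Submodule.mul_mem_mul h₁ h₂
      · rw [wordPiece, add_comm, pow_add]
        exact Submodule.mul_mem_mul h₂ h₁
  refine Submodule.span_induction (p := fun b _ => freeLieToAssoc K ι b ∈ wordPiece K ι n)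
    (fun b hb => key hb) ?_ ?_ ?_ ha
  · simp
  · intro b c _ _ h₁ h₂
    rw [map_add]
    exact Submodule.add_mem _ h₁ h₂
  · intro r b _ h₁
    rw [map_smul]
    exact Submodule.smul_mem _ _ h₁

/-- The graded completion of the free Lie algebra `L` generated by `X` (index `0`) and
`Y` (index `1`). -/
abbrev FreeLieCompletion (K : Type*) [CommRing K] : Type _ :=
  gradedCompletion K (FreeLieAlgebra.of K : Fin 2 → FreeLieAlgebra K (Fin 2))

/-- The canonical map from the graded completion of the free Lie algebra to the algebra of
non-commutative power series, in which brackets become commutators. -/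
noncomputable def toNCSeries (K : Type*) [CommRing K] :
    FreeLieCompletion K →ₗ[K] ncSeries K (Fin 2) where
  toFun f := ⟨PowerSeries.mk fun n => freeLieToAssoc K (Fin 2) (LieSeries.coeff n f.1), by
    intro n
    rw [PowerSeries.coeff_mk]
    exact freeLieToAssoc_mem (f.2 n)⟩
  map_add' f h := Subtype.ext <| PowerSeries.ext fun n => by
    change PowerSeries.coeff n (PowerSeries.mk fun n => freeLieToAssoc K (Fin 2)
        (LieSeries.coeff n f.1 + LieSeries.coeff n h.1)) =
      PowerSeries.coeff n
        ((PowerSeries.mk fun n => freeLieToAssoc K (Fin 2) (LieSeries.coeff n f.1)) +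
          PowerSeries.mk fun n => freeLieToAssoc K (Fin 2) (LieSeries.coeff n h.1))
    simp
  map_smul' c f := Subtype.ext <| PowerSeries.ext fun n => by
    change PowerSeries.coeff n (PowerSeries.mk fun n => freeLieToAssoc K (Fin 2)
        (c • LieSeries.coeff n f.1)) =
      PowerSeries.coeff n
        (c • PowerSeries.mk fun n => freeLieToAssoc K (Fin 2) (LieSeries.coeff n f.1))
    simp

/-- The ideal `[[L, L], [L, L]]` of the free Lie algebra `L` on two generators. -/
noncomputable def secondDerived (K : Type*) [CommRing K] : LieIdeal K (FreeLieAlgebra K (Fin 2)) :=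
  ⁅⁅(⊤ : LieIdeal K (FreeLieAlgebra K (Fin 2))), (⊤ : LieIdeal K (FreeLieAlgebra K (Fin 2)))⁆,
    ⁅(⊤ : LieIdeal K (FreeLieAlgebra K (Fin 2))), (⊤ : LieIdeal K (FreeLieAlgebra K (Fin 2)))⁆⁆

/-- The free metabelian Lie algebra `L / [[L, L], [L, L]]`. -/
abbrev FreeMetabelian (K : Type*) [CommRing K] : Type _ :=
  FreeLieAlgebra K (Fin 2) ⧸ secondDerived K

/-- The quotient map `L → L / [[L, L], [L, L]]`. -/
noncomputable def metabelianMk (K : Type*) [CommRing K] : FreeLieAlgebra K (Fin 2) →ₗ⁅K⁆ FreeMetabelian K :=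
  { LieSubmodule.Quotient.mk' (secondDerived K) with
    map_lie' := by
      intro a b
      exact LieSubmodule.Quotient.mk_bracket (I := secondDerived K) a b }

/-- The images of `X` and `Y` in the free metabelian Lie algebra. -/
noncomputable def metabelianGen (K : Type*) [CommRing K] (i : Fin 2) : FreeMetabelian K :=
  metabelianMk K (FreeLieAlgebra.of K i)

/-- The graded completion of the free metabelian Lie algebra. -/
abbrev FreeMetabelianCompletion (K : Type*) [CommRing K] : Type _ :=
  gradedCompletion K (metabelianGen K)

/-- The homomorphism of graded completions induced by `L → L / [[L, L], [L, L]]`. -/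
noncomputable def toMetabelian (K : Type*) [CommRing K] :
    FreeLieCompletion K →ₗ⁅K⁆ FreeMetabelianCompletion K :=
  completionMap (metabelianMk K) (FreeLieAlgebra.of K)

end Free

/-! ### The coefficient function -/

section Fraction

/-- The field of fractions of the ring of commutative power series in `x` and `y`. -/
abbrev SeriesFractions (K : Type*) [Field K] : Type _ :=
  FractionRing (MvPowerSeries (Fin 2) K)

/-- `e^P` for a commutative power series `P` in `x`, `y` with zero constant term. -/
noncomputable def commExp {K : Type*} [Field K] [CharZero K] (P : MvPowerSeries (Fin 2) K) :
    MvPowerSeries (Fin 2) K :=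
  PowerSeries.subst P (PowerSeries.exp K)

/-- The fraction `(1/y) (1 - ((e^x - 1)/x) ((x + y)/(e^(x + y) - 1)))`. -/
noncomputable def metabelianFraction (K : Type*) [Field K] [CharZero K] : SeriesFractions K :=
  let c : MvPowerSeries (Fin 2) K →+* SeriesFractions K := algebraMap _ _
  let x : MvPowerSeries (Fin 2) K := MvPowerSeries.X 0
  let y : MvPowerSeries (Fin 2) K := MvPowerSeries.X 1
  (1 / c y) * (1 - ((c (commExp x) - 1) / c x) * (c (x + y) / (c (commExp (x + y)) - 1)))

end Fraction

end MetabelianBCH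

/-! Notation: `t` is the variable that records the degree, `q(u) = (e^u - 1)/u`, and `s = x + y`.

`H` is a Lie series because of the Euler derivation `E`, which multiplies the degree `n` component
by `n`. It satisfies `E(e^P) = N(P) e^P` with `N(P) = ∑ (ad P)^k (E P) / (k+1)!` (`euler_exp`), so
`e^H = e^X e^Y` gives `N(H) = N(X) + e^(ad X) N(Y)`. The right side is Lie. In degree `n` the left
side is `n H_n` plus commutators of terms of `H` of lower degree, so induction and division by `n`
show that `H_n` is Lie (`coeff_mem_of_exp_eq_exp_mul_exp`). The preimage is unique because the
Dynkin operator recovers `n a` from the image of a Lie element `a` of degree `n`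
(`freeLieToAssoc_injOn`).

In the metabelian quotient, `ad X` and `ad Y` commute on brackets, so the proposed family spans.
Independence comes from the affine representation `X ↦ (f ↦ x f + 1)`, `Y ↦ (f ↦ y f)`. It kills
`[[L, L], [L, L]]`, its linear part detects `X` and `Y`, and its translation part sends `[X^k Y^l X
Y]` to `-x^k y^(l+1)`. Hence the two parts together separate points
(`eq_of_linear_eq_of_translation_eq`).

It remains to compute these parts for `H`. The matrix `M = e^X e^Y - 1` has first row `(e^(st) - 1,
t q(xt))` and zero second row. Therefore the first row of `H` is a scalar multiple of that of `M`;
its first entry must be `s t`, so its second is `t q(xt) / q(st)`. For `X + Y + h(ad X, ad Y)[X, Y]`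
the translation part is `t - y t² h(xt, yt)`, and equality of the two is the formula for `h`. -/

namespace MetabelianBCH

/-! ### Substitution into scalar power series over a non-commutative ring -/

section Summation

open PowerSeries Finset

variable {K B : Type*} [Field K] [Ring B] [Algebra K B]

/-- The sum of a sequence of power series whose `m`-th term has order at least `m`. -/
noncomputable def seriesSum (f : ℕ → PowerSeries B) : PowerSeries B :=
  PowerSeries.mk fun n => ∑ m ∈ range (n + 1), coeff n (f m)

/-- The `m`-th term has order at least `m`. -/
def OrderGrows (f : ℕ → PowerSeries B) : Prop := ∀ m n, n < m → coeff n (f m) = 0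

theorem coeff_seriesSum {f : ℕ → PowerSeries B} (hf : OrderGrows f) {n N : ℕ} (h : n < N) :
    coeff n (seriesSum f) = ∑ m ∈ range N, coeff n (f m) := by
  rw [seriesSum, coeff_mk]
  refine sum_subset (range_subset_range.2 h) fun m _ hm => hf m n ?_
  simp at hm
  omega

theorem coeff_mul_eq_zero {P Q : PowerSeries B} {i j n : ℕ} (hP : ∀ k < i, coeff k P = 0)
    (hQ : ∀ k < j, coeff k Q = 0) (hn : n < i + j) : coeff n (P * Q) = 0 := by
  rw [coeff_mul]
  refine sum_eq_zero fun p hp => ?_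
  have := mem_antidiagonal.1 hp
  rcases lt_or_ge p.1 i with h | h
  · rw [hP _ h, zero_mul]
  · rw [hQ _ (by omega), mul_zero]

theorem orderGrows_pow {P : PowerSeries B} (hP : coeff 0 P = 0) : OrderGrows fun m => P ^ m := by
  intro m
  induction m with
  | zero => intro n h; omega
  | succ m ih =>
    intro n h
    change coeff n (P ^ (m + 1)) = 0
    rw [pow_succ]
    exact coeff_mul_eq_zero ih (j := 1) (fun k hk => by rwa [Nat.lt_one_iff.1 hk]) h

theorem OrderGrows.smul {f : ℕ → PowerSeries B} (hf : OrderGrows f) (c : ℕ → K) :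
    OrderGrows fun m => c m • f m := by
  intro m n h
  change c m • coeff n (f m) = 0
  rw [hf m n h, smul_zero]

/-- In degree `n` only finitely many terms matter: the product gives a sum over the square `i, j ≤
n`, the Cauchy product one over the triangle `i + j ≤ n`, and the pairs outside the triangle have
order above `n`. -/
theorem seriesSum_mul {f g : ℕ → PowerSeries B} (hf : OrderGrows f) (hg : OrderGrows g) :
    seriesSum f * seriesSum g = seriesSum fun m => ∑ p ∈ antidiagonal m, f p.1 * g p.2 := by
  ext n
  have h : ∀ N, n < N → coeff n (seriesSum f * seriesSum g) =
      coeff n ((∑ i ∈ range N, f i) * ∑ j ∈ range N, g j) := by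
    intro N hN
    rw [coeff_mul, coeff_mul]
    refine sum_congr rfl fun p hp => ?_
    have := mem_antidiagonal.1 hp
    rw [coeff_seriesSum hf (show p.1 < N by omega), coeff_seriesSum hg (show p.2 < N by omega),
      map_sum, map_sum]
  rw [h (n + 1) (by omega), seriesSum, coeff_mk, sum_mul_sum, ← sum_product', map_sum]
  simp only [map_sum]
  rw [sum_sigma']
  symm
  refine sum_of_injOn (fun a => a.2) ?_ ?_ ?_ ?_
  · rintro ⟨m, p⟩ ha ⟨m', p'⟩ ha' h
    simp at ha ha' h
    subst h
    simp; omega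
  · rintro ⟨m, p⟩ ha
    simp at ha ⊢
    omega
  · rintro ⟨i, j⟩ _ h
    refine coeff_mul_eq_zero (hf i) (hg j) ?_
    by_contra hlt
    exact h ⟨⟨i + j, i, j⟩, by simp; omega, rfl⟩
  · rintro ⟨m, p⟩ _
    rfl

theorem seriesSum_succ {f : ℕ → PowerSeries B} (hf : OrderGrows f) (h0 : f 0 = 0) :
    seriesSum f = seriesSum fun m => f (m + 1) := by
  ext n
  rw [coeff_seriesSum hf (show n < n + 1 + 1 by omega), sum_range_succ', h0, map_zero, add_zero,
    seriesSum, coeff_mk]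

/-- Substitution of a power series with zero constant coefficient and possibly non-commuting
coefficients into a power series with scalar coefficients. -/
noncomputable def scalarSubst (F : PowerSeries K) (P : PowerSeries B) : PowerSeries B :=
  seriesSum fun m => coeff m F • P ^ m

theorem coeff_scalarSubst (F : PowerSeries K) {P : PowerSeries B} (hP : coeff 0 P = 0) {n N : ℕ}
    (h : n < N) : coeff n (scalarSubst F P) = ∑ m ∈ range N, coeff m F • coeff n (P ^ m) :=
  coeff_seriesSum ((orderGrows_pow hP).smul _) h

theorem coeff_zero_scalarSubst (F : PowerSeries K) {P : PowerSeries B} :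
    coeff 0 (scalarSubst F P) = algebraMap K B (coeff 0 F) := by
  simp [scalarSubst, seriesSum, Algebra.algebraMap_eq_smul_one]

theorem scalarSubst_one (P : PowerSeries B) (hP : coeff 0 P = 0) :
    scalarSubst (1 : PowerSeries K) P = 1 := by
  ext n
  rw [coeff_scalarSubst _ hP (Nat.lt_succ_self n)]
  simp [coeff_one, ite_smul]

theorem scalarSubst_X (P : PowerSeries B) (hP : coeff 0 P = 0) :
    scalarSubst (X : PowerSeries K) P = P := by
  ext n
  rw [coeff_scalarSubst _ hP (show n < n + 2 by omega)]
  simp [coeff_X, ite_smul]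

theorem scalarSubst_add (F G : PowerSeries K) (P : PowerSeries B) :
    scalarSubst (F + G) P = scalarSubst F P + scalarSubst G P := by
  ext n
  simp [scalarSubst, seriesSum, add_smul, sum_add_distrib]

/-- Non-commutativity of `B` does no harm: only powers of the single element `P` and scalars are
multiplied. -/
theorem scalarSubst_mul (F G : PowerSeries K) {P : PowerSeries B} (hP : coeff 0 P = 0) :
    scalarSubst (F * G) P = scalarSubst F P * scalarSubst G P := by
  rw [scalarSubst, scalarSubst, scalarSubst,
    seriesSum_mul ((orderGrows_pow hP).smul _) ((orderGrows_pow hP).smul _)]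
  congr 1
  funext m
  rw [coeff_mul, sum_smul]
  refine sum_congr rfl fun p hp => ?_
  rw [smul_mul_smul_comm, ← pow_add, mem_antidiagonal.1 hp]

theorem scalarSubst_pow (F : PowerSeries K) {P : PowerSeries B} (hP : coeff 0 P = 0) (m : ℕ) :
    scalarSubst (F ^ m) P = scalarSubst F P ^ m := by
  induction m with
  | zero => rw [pow_zero, pow_zero, scalarSubst_one P hP]
  | succ m ih => rw [pow_succ, pow_succ, scalarSubst_mul _ _ hP, ih]

theorem scalarSubst_scalarSubst (F : PowerSeries K) {G : PowerSeries K} {P : PowerSeries B}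
    (hG : coeff 0 G = 0) (hP : coeff 0 P = 0) :
    scalarSubst F (scalarSubst G P) = scalarSubst (scalarSubst F G) P := by
  ext n
  have h0 : coeff 0 (scalarSubst G P) = 0 := by rw [coeff_zero_scalarSubst, hG, map_zero]
  rw [coeff_scalarSubst _ h0 (Nat.lt_succ_self n), coeff_scalarSubst _ hP (Nat.lt_succ_self n)]
  simp_rw [← scalarSubst_pow G hP, coeff_scalarSubst _ hP (Nat.lt_succ_self n), smul_sum]
  rw [sum_comm]
  refine sum_congr rfl fun j hj => ?_
  rw [coeff_scalarSubst F hG (mem_range.1 hj), sum_smul]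
  simp [smul_smul]

theorem scalarSubst_eq_subst (F : PowerSeries K) {G : PowerSeries K} (hG : coeff 0 G = 0) :
    scalarSubst F G = F.subst G := by
  ext n
  rw [coeff_subst' (HasSubst.of_constantCoeff_zero' (by simpa using hG)),
    coeff_scalarSubst F hG (Nat.lt_succ_self n),
    finsum_eq_sum_of_support_subset]
  intro m hm
  by_contra h
  simp at h
  exact hm (by simp [orderGrows_pow hG m n (by omega)])

end Summation

/-! ### `exp` and `log` as mutually inverse series -/

section ExpLog

open PowerSeries

variable (K : Type*) [Field K] [CharZero K]

/-- Both sides have zero constant term and derivative `1`: `log K` is the series of `log (1 + X)`,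
and substituting `exp K - 1` into `(1 + X) log' = 1` gives `exp · log'(exp - 1) = 1`. -/
theorem log_subst_exp_sub_one : (log K).subst (exp K - 1) = X := by
  have hs : HasSubst (exp K - 1) := HasSubst.exp_sub_one
  have h1 : (1 + X) * d⁄dX K (log K) = 1 := by
    rw [deriv_log]
    ext n
    rw [add_mul, one_mul, map_add]
    cases n with
    | zero => simp
    | succ n =>
      rw [coeff_succ_X_mul, coeff_mk, coeff_mk, coeff_one, if_neg (Nat.succ_ne_zero n), pow_succ]
      simp
  have h2 : exp K * (d⁄dX K (log K)).subst (exp K - 1) = 1 := by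
    have h := congrArg (fun F : PowerSeries K => F.subst (exp K - 1)) h1
    have hone : (1 : PowerSeries K).subst (exp K - 1) = 1 := by
      rw [← coe_substAlgHom hs, map_one]
    simp only [subst_mul hs, subst_add hs, subst_X hs] at h
    rw [hone] at h
    rwa [add_sub_cancel] at h
  refine derivative.ext ?_ ?_
  · rw [derivative_subst hs, map_sub, derivative_exp, Derivation.map_one_eq_zero, sub_zero,
      mul_comm, h2]
    simp
  · rw [constantCoeff_X]
    exact constantCoeff_subst_eq_zero (by simp [← constantCoeff_eq]) _ constantCoeff_log

/-- A left inverse equals a right inverse: `exp K - 1` has a compositional right inverse `G`, and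
composing `log ∘ (exp - 1) = X` with `G` gives `log = G`. -/
theorem exp_sub_one_subst_log : (exp K - 1).subst (log K) = X := by
  have hc : constantCoeff (exp K - 1) = 0 := by simp
  have h1 : IsUnit (coeff 1 (exp K - 1)) := by simp [coeff_one]
  set G := (exp K - 1).substInvOfIsUnit h1
  have hG : HasSubst G := HasSubst.substInvOfIsUnit _ h1
  have hr : (exp K - 1).subst G = X := subst_substInvOfIsUnit_right _ hc h1
  have hlog : log K = G := by
    have h := subst_comp_subst_apply (HasSubst.exp_sub_one (A := K)) hG (log K)
    rw [log_subst_exp_sub_one, hr, X_subst, subst_X hG] at h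
    exact h.symm
  rw [hlog, hr]

theorem scalarSubst_exp_log : scalarSubst (exp K) (log K) = 1 + X := by
  have h0 : coeff 0 (log K) = 0 := by simp
  have h := exp_sub_one_subst_log K
  rw [← scalarSubst_eq_subst _ h0] at h
  rw [← h]
  conv_lhs => rw [← add_sub_cancel 1 (exp K)]
  rw [scalarSubst_add, scalarSubst_one _ h0]

theorem scalarSubst_log_exp_sub_one : scalarSubst (log K) (exp K - 1) = X := by
  rw [scalarSubst_eq_subst _ (by simp), log_subst_exp_sub_one]

end ExpLog

/-! ### The Euler derivation and the logarithmic derivative of `e^P` -/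

section Euler

open PowerSeries Finset

variable {K B : Type*} [Field K] [Ring B] [Algebra K B]

/-- The derivation that multiplies the homogeneous component of degree `n` by `n`. -/
noncomputable def euler (P : PowerSeries B) : PowerSeries B :=
  PowerSeries.mk fun n => n • coeff n P

theorem coeff_euler (n : ℕ) (P : PowerSeries B) : coeff n (euler P) = n • coeff n P :=
  coeff_mk _ _

theorem euler_mul (P Q : PowerSeries B) : euler (P * Q) = euler P * Q + P * euler Q := by
  ext n
  rw [coeff_euler, map_add, coeff_mul, coeff_mul, coeff_mul, smul_sum, ← sum_add_distrib]
  refine sum_congr rfl fun p hp => ?_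
  rw [coeff_euler, coeff_euler, ← mem_antidiagonal.1 hp, add_smul, smul_mul_assoc, mul_smul_comm]

theorem euler_smul (c : K) (P : PowerSeries B) : euler (c • P) = c • euler P := by
  ext n
  rw [coeff_euler]
  change n • (c • coeff n P) = c • coeff n (euler P)
  rw [coeff_euler, smul_comm]

theorem euler_one : euler (1 : PowerSeries B) = 0 := by
  ext n
  rw [coeff_euler, coeff_one]
  split_ifs with h <;> simp [h]

theorem euler_seriesSum (f : ℕ → PowerSeries B) :
    euler (seriesSum f) = seriesSum fun m => euler (f m) := by
  ext n
  simp only [coeff_euler, seriesSum, coeff_mk, smul_sum]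

theorem seriesSum_mul_const {f : ℕ → PowerSeries B} (hf : OrderGrows f) (D : PowerSeries B) :
    seriesSum f * D = seriesSum fun m => f m * D := by
  ext n
  rw [seriesSum, seriesSum, coeff_mk, coeff_mul]
  simp only [coeff_mul]
  rw [sum_comm]
  refine sum_congr rfl fun p hp => ?_
  have := mem_antidiagonal.1 hp
  rw [← sum_mul, ← coeff_seriesSum hf (show p.1 < n + 1 by omega), seriesSum]

variable (K) in
/-- The commutator with `P`. -/
noncomputable def commutator (P : PowerSeries B) : Module.End K (PowerSeries B) :=
  LinearMap.mulLeft K P - LinearMap.mulRight K P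

theorem commutator_apply (P D : PowerSeries B) : commutator K P D = P * D - D * P := rfl

theorem commutator_pow_succ (P D : PowerSeries B) (k : ℕ) :
    (commutator K P ^ (k + 1)) D =
      P * (commutator K P ^ k) D - (commutator K P ^ k) D * P := by
  rw [pow_succ', Module.End.mul_apply, commutator_apply]

theorem orderGrows_commutator_pow {P : PowerSeries B} (hP : coeff 0 P = 0) (D : PowerSeries B) :
    OrderGrows fun k => (commutator K P ^ k) D := by
  have h1 : ∀ k < 1, coeff k P = 0 := fun k hk => by rwa [Nat.lt_one_iff.1 hk]
  intro k
  induction k with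
  | zero => intro n h; omega
  | succ k ih =>
    intro n h
    change coeff n ((commutator K P ^ (k + 1)) D) = 0
    rw [commutator_pow_succ, map_sub, coeff_mul_eq_zero h1 ih (by omega),
      coeff_mul_eq_zero ih h1 h, sub_zero]

variable (K) in
-- Left multiplication by `P` is the sum of `ad P` and right multiplication by `P`; these operators
-- commute, so the binomial theorem applies.
theorem pow_mul_eq_sum_commutator (P D : PowerSeries B) (m : ℕ) :
    P ^ m * D = ∑ p ∈ antidiagonal m, m.choose p.1 • ((commutator K P ^ p.1) D * P ^ p.2) := by
  have hc : Commute (LinearMap.mulRight K P) (commutator K P) := by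
    refine Commute.sub_right ?_ (Commute.refl _)
    ext D : 1
    simp [mul_assoc]
  have h := congrArg (fun f : Module.End K (PowerSeries B) => f D)
    ((hc.symm).add_pow' m)
  simp only [commutator, sub_add_cancel, LinearMap.pow_mulLeft, LinearMap.mulLeft_apply] at h
  rw [h, LinearMap.sum_apply]
  refine sum_congr rfl fun p _ => ?_
  have h2 := (hc.symm.pow_pow p.1 p.2).eq
  rw [commutator] at h2 ⊢
  rw [LinearMap.smul_apply, h2, Module.End.mul_apply, LinearMap.pow_mulRight,
    LinearMap.mulRight_apply]

variable (K) in
-- The power rule with all factors `P` moved to the right. In the induction, `E(P^(m+1)) P` and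
-- `P^(m+1) E(P)` have expansions that add up by Pascal's rule.
theorem euler_pow_succ (P : PowerSeries B) (m : ℕ) :
    euler (P ^ (m + 1)) = ∑ p ∈ antidiagonal m,
      (m + 1).choose (p.1 + 1) • ((commutator K P ^ p.1) (euler P) * P ^ p.2) := by
  induction m with
  | zero => simp
  | succ m ih =>
    -- The extra term at `(m + 1, 0)` has binomial coefficient zero; it lets both expansions run
    -- over the same antidiagonal.
    have h : ∑ p ∈ antidiagonal (m + 1),
        (m + 1).choose (p.1 + 1) • ((commutator K P ^ p.1) (euler P) * P ^ p.2) =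
          euler (P ^ (m + 1)) * P := by
      rw [Nat.sum_antidiagonal_succ', Nat.choose_succ_self, zero_smul, zero_add, ih, sum_mul]
      refine sum_congr rfl fun p _ => ?_
      rw [pow_succ, smul_mul_assoc, mul_assoc]
    rw [pow_succ, euler_mul, ← h, pow_mul_eq_sum_commutator K P (euler P) (m + 1),
      ← sum_add_distrib]
    refine sum_congr rfl fun p _ => ?_
    rw [← add_smul, Nat.choose_succ_succ (m + 1) p.1, add_comm]

variable [CharZero K]

theorem coeff_exp_eq_inv (n : ℕ) : coeff n (exp K) = ((n.factorial : ℕ) : K)⁻¹ := by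
  simp [coeff_exp]

theorem coeff_exp_mul_choose {i j m : ℕ} (h : i + j = m) :
    coeff m (exp K) * (m.choose i : K) = coeff i (exp K) * coeff j (exp K) := by
  subst h
  simp only [coeff_exp_eq_inv]
  rw [Nat.cast_add_choose]
  have := fun n : ℕ => (Nat.cast_ne_zero (R := K)).2 n.factorial_ne_zero
  field_simp [this]

variable (K) in
/-- The left logarithmic derivative `∑ k, (ad P)^k (euler P) / (k + 1)!` of `e^P`. -/
noncomputable def expLogDeriv (P : PowerSeries B) : PowerSeries B :=
  seriesSum fun k => coeff (k + 1) (exp K) • (commutator K P ^ k) (euler P)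

variable (K) in
/-- The conjugate `e^P D e^(-P) = ∑ k, (ad P)^k D / k!`. -/
noncomputable def expConj (P D : PowerSeries B) : PowerSeries B :=
  seriesSum fun k => coeff k (exp K) • (commutator K P ^ k) D

/-- `E` kills the term `m = 0`, hence the shift of index; then `C(m+1, i+1) / (m+1)! = 1 / ((i+1)!
j!)` for `i + j = m` turns the power rule into a Cauchy product. -/
theorem euler_exp {P : PowerSeries B} (hP : coeff 0 P = 0) :
    euler (scalarSubst (exp K) P) = expLogDeriv K P * scalarSubst (exp K) P := by
  have hg : OrderGrows fun m => euler (coeff m (exp K) • P ^ m) := fun m n h => by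
    rw [coeff_euler, (orderGrows_pow hP).smul (fun m => coeff m (exp K)) m n h, smul_zero]
  rw [expLogDeriv, scalarSubst, euler_seriesSum, seriesSum_succ hg (by
      rw [pow_zero, euler_smul, euler_one, smul_zero]),
    seriesSum_mul ((orderGrows_commutator_pow hP _).smul _) ((orderGrows_pow hP).smul _)]
  congr 1
  funext m
  rw [euler_smul, euler_pow_succ K, smul_sum]
  refine sum_congr rfl fun p hp => ?_
  rw [smul_mul_smul_comm, ← coeff_exp_mul_choose (m := m + 1)
    (by have := mem_antidiagonal.1 hp; omega), mul_smul, Nat.cast_smul_eq_nsmul]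

theorem exp_mul_eq {P : PowerSeries B} (hP : coeff 0 P = 0) (D : PowerSeries B) :
    scalarSubst (exp K) P * D = expConj K P D * scalarSubst (exp K) P := by
  rw [expConj, scalarSubst, seriesSum_mul_const ((orderGrows_pow hP).smul _),
    seriesSum_mul ((orderGrows_commutator_pow hP _).smul _) ((orderGrows_pow hP).smul _)]
  congr 1
  funext m
  rw [smul_mul_assoc, pow_mul_eq_sum_commutator K, smul_sum]
  refine sum_congr rfl fun p hp => ?_
  rw [smul_mul_smul_comm, ← coeff_exp_mul_choose (mem_antidiagonal.1 hp), mul_smul,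
    Nat.cast_smul_eq_nsmul]

theorem coeff_zero_scalarSubst_exp (P : PowerSeries B) :
    coeff 0 (scalarSubst (exp K) P) = 1 := by
  rw [coeff_zero_scalarSubst]
  simp

theorem eq_of_mul_eq_mul_of_coeff_zero {P Q U : PowerSeries B} (hU : coeff 0 U = 1)
    (h : P * U = Q * U) : P = Q := by
  ext n
  induction n using Nat.strong_induction_on with
  | _ n ih =>
    have h := congrArg (coeff n) h
    rw [coeff_mul, coeff_mul, Nat.sum_antidiagonal_eq_sum_range_succ_mk,
      Nat.sum_antidiagonal_eq_sum_range_succ_mk, sum_range_succ, sum_range_succ,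
      sum_congr rfl fun i hi => by rw [ih i (mem_range.1 hi)]] at h
    simpa [hU] using h

end Euler

/-! ### Baker–Campbell–Hausdorff by induction on the degree -/

section LieCoefficients

open PowerSeries Finset

variable {K B : Type*} [Field K] [Ring B] [Algebra K B]

/-- The coefficients of degree less than `n` lie in the given graded pieces. -/
def CoeffsMem (S : ℕ → Submodule K B) (n : ℕ) (P : PowerSeries B) : Prop :=
  ∀ k < n, coeff k P ∈ S k

variable {S : ℕ → Submodule K B}

theorem CoeffsMem.mono {m n : ℕ} (h : m ≤ n) {P : PowerSeries B} (hP : CoeffsMem S n P) :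
    CoeffsMem S m P := fun k hk => hP k (by omega)

theorem CoeffsMem.euler {n : ℕ} {P : PowerSeries B} (hP : CoeffsMem S n P) :
    CoeffsMem S n (euler P) := fun k hk => by
  rw [coeff_euler]
  exact (S k).smul_of_tower_mem k (hP k hk)

theorem CoeffsMem.smul {n : ℕ} {P : PowerSeries B} (hP : CoeffsMem S n P) (c : K) :
    CoeffsMem S n (c • P) := fun k hk => (S k).smul_mem c (hP k hk)

theorem CoeffsMem.add {n : ℕ} {P Q : PowerSeries B} (hP : CoeffsMem S n P)
    (hQ : CoeffsMem S n Q) : CoeffsMem S n (P + Q) := fun k hk => by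
  rw [map_add]
  exact (S k).add_mem (hP k hk) (hQ k hk)

theorem CoeffsMem.seriesSum {n : ℕ} {f : ℕ → PowerSeries B} (hf : ∀ m, CoeffsMem S n (f m)) :
    CoeffsMem S n (seriesSum f) := fun k hk => by
  rw [MetabelianBCH.seriesSum, coeff_mk]
  exact (S k).sum_mem fun m _ => hf m k hk

theorem coeff_zero_commutator {P : PowerSeries B} (hP : coeff 0 P = 0) (D : PowerSeries B) :
    coeff 0 (commutator K P D) = 0 := by
  rw [commutator_apply, map_sub, coeff_mul, coeff_mul]
  simp_all

theorem coeff_zero_commutator_pow {P D : PowerSeries B} (hP : coeff 0 P = 0)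
    (hD : coeff 0 D = 0) (k : ℕ) : coeff 0 ((commutator K P ^ k) D) = 0 := by
  cases k with
  | zero => rwa [pow_zero, Module.End.one_apply]
  | succ k => rw [pow_succ', Module.End.mul_apply, coeff_zero_commutator hP]

variable (hS : ∀ i j, ∀ a ∈ S i, ∀ b ∈ S j, a * b - b * a ∈ S (i + j))

include hS

/-- The gain of one degree drives the induction: since both constant terms vanish, degree `n` of the
commutator involves only degrees below `n` of each factor. -/
theorem CoeffsMem.commutator {n : ℕ} {P D : PowerSeries B} (hP0 : coeff 0 P = 0)
    (hD0 : coeff 0 D = 0) (hP : CoeffsMem S n P) (hD : CoeffsMem S n D) :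
    CoeffsMem S (n + 1) (commutator K P D) := fun k hk => by
  rw [commutator_apply, map_sub, coeff_mul, coeff_mul, ← Nat.sum_antidiagonal_swap (n := k)
    (f := fun p => coeff p.1 D * coeff p.2 P), ← sum_sub_distrib]
  refine (S k).sum_mem fun p hp => ?_
  have hp := mem_antidiagonal.1 hp
  simp only [Prod.fst_swap, Prod.snd_swap]
  rcases Nat.eq_zero_or_pos p.1 with h1 | h1
  · simp [h1, hP0]
  rcases Nat.eq_zero_or_pos p.2 with h2 | h2
  · simp [h2, hD0]
  rw [← hp]
  exact hS _ _ _ (hP _ (by omega)) _ (hD _ (by omega))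

theorem CoeffsMem.commutator_pow_succ {n : ℕ} {P D : PowerSeries B} (hP0 : coeff 0 P = 0)
    (hD0 : coeff 0 D = 0) (hP : CoeffsMem S n P) (hD : CoeffsMem S n D) (k : ℕ) :
    CoeffsMem S (n + 1) ((MetabelianBCH.commutator K P ^ (k + 1)) D) := by
  induction k with
  | zero => simpa using hP.commutator hS hP0 hD0 hD
  | succ k ih =>
    rw [pow_succ', Module.End.mul_apply]
    exact hP.commutator hS hP0 (coeff_zero_commutator_pow hP0 hD0 _) (ih.mono n.le_succ)

theorem CoeffsMem.commutator_pow {n : ℕ} {P D : PowerSeries B} (hP0 : coeff 0 P = 0)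
    (hD0 : coeff 0 D = 0) (hP : CoeffsMem S n P) (hD : CoeffsMem S n D) (k : ℕ) :
    CoeffsMem S n ((MetabelianBCH.commutator K P ^ k) D) := by
  cases k with
  | zero => simpa
  | succ k => exact (hP.commutator_pow_succ hS hP0 hD0 hD k).mono n.le_succ

/-- The Baker–Campbell–Hausdorff theorem: if `P` and `Q` are Lie series and `e^H = e^P e^Q`,
then `H` is a Lie series. -/
theorem coeff_mem_of_exp_eq_exp_mul_exp [CharZero K] {P Q H : PowerSeries B}
    (hP0 : coeff 0 P = 0) (hQ0 : coeff 0 Q = 0) (hH0 : coeff 0 H = 0)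
    (hP : ∀ n, coeff n P ∈ S n) (hQ : ∀ n, coeff n Q ∈ S n)
    (hH : scalarSubst (exp K) H = scalarSubst (exp K) P * scalarSubst (exp K) Q) (n : ℕ) :
    coeff n H ∈ S n := by
  have e0 : ∀ {R : PowerSeries B}, coeff 0 R = 0 → coeff 0 (MetabelianBCH.euler R) = 0 := by
    intro R _
    rw [coeff_euler, zero_smul]
  -- Apply the Euler derivation to `e^H = e^P e^Q`, move `N(Q)` to the left of `e^P`, and cancel
  -- `e^H`.
  have key : expLogDeriv K H = expLogDeriv K P + expConj K P (expLogDeriv K Q) := by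
    refine eq_of_mul_eq_mul_of_coeff_zero (coeff_zero_scalarSubst_exp (K := K) H) ?_
    rw [← euler_exp hH0, hH, euler_mul, euler_exp hP0, euler_exp hQ0, add_mul, ← mul_assoc,
      ← mul_assoc, ← mul_assoc, ← exp_mul_eq hP0, mul_assoc (scalarSubst (exp K) P)]
  have hN : ∀ {R : PowerSeries B}, coeff 0 R = 0 → (∀ n, coeff n R ∈ S n) → ∀ n,
      CoeffsMem S n (expLogDeriv K R) := fun h0 h n =>
    CoeffsMem.seriesSum fun k => (CoeffsMem.commutator_pow hS h0 (e0 h0) (fun k _ => h k)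
      (CoeffsMem.euler fun k _ => h k) k).smul _
  have hN0 : coeff 0 (expLogDeriv K Q) = 0 := by
    rw [expLogDeriv, MetabelianBCH.seriesSum, coeff_mk, sum_range_one, pow_zero,
      Module.End.one_apply]
    change coeff (0 + 1) (exp K) • coeff 0 (MetabelianBCH.euler Q) = 0
    rw [e0 hQ0, smul_zero]
  have hM : CoeffsMem S (n + 1) (expLogDeriv K H) := by
    rw [key]
    refine (hN hP0 hP _).add (CoeffsMem.seriesSum fun k => ?_)
    exact (CoeffsMem.commutator_pow hS hP0 hN0 (fun k _ => hP k) (hN hQ0 hQ _) k).smul _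
  induction n using Nat.strong_induction_on with
  | _ n ih =>
    rcases Nat.eq_zero_or_pos n with rfl | hn
    · rw [hH0]
      exact zero_mem _
    have ihH : CoeffsMem S n H := fun k hk => ih k hk (hM.mono (by omega))
    have h := hM n (by omega)
    -- Only the term `k = 0` involves `H_n`, as `n H_n`; the terms with a commutator are already
    -- known to lie in `S n`.
    rw [expLogDeriv, MetabelianBCH.seriesSum, coeff_mk, sum_range_succ',
      Submodule.add_mem_iff_right] at h
    · have h1 : coeff n (coeff (0 + 1) (exp K) • (MetabelianBCH.commutator K H ^ 0)
          (MetabelianBCH.euler H)) = (n : K) • coeff n H := by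
        simp [coeff_euler, Nat.cast_smul_eq_nsmul, coeff_exp]
      rw [h1] at h
      exact (Submodule.smul_mem_iff _ (Nat.cast_ne_zero.2 hn.ne')).1 h
    · exact (S n).sum_mem fun k _ => (CoeffsMem.commutator_pow_succ hS hH0 (e0 hH0) ihH
        ihH.euler k).smul _ n (by omega)

end LieCoefficients

/-! ### The Dynkin operator -/

section FreeLie

theorem lie_mem_degreePiece {K M ι : Type*} [CommRing K] [LieRing M] [LieAlgebra K M] {g : ι → M}
    {m n : ℕ} {a b : M} (ha : a ∈ degreePiece K g m) (hb : b ∈ degreePiece K g n) :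
    ⁅a, b⁆ ∈ degreePiece K g (m + n) := by
  have h := Submodule.apply_mem_map₂ (LieModule.toEnd K M M : M →ₗ[K] M →ₗ[K] M) ha hb
  rw [degreePiece, degreePiece, Submodule.map₂_span_span] at h
  refine Submodule.span_mono ?_ h
  rintro _ ⟨a, ha, b, hb, rfl⟩
  exact IsLieMonomial.bracket ha hb

variable (K : Type*) {ι : Type*} [CommRing K]

theorem freeLieToAssoc_of (i : ι) :
    freeLieToAssoc K ι (FreeLieAlgebra.of K i) = FreeAlgebra.ι K i := by
  let _ : LieRing (FreeAlgebra K ι) := LieRing.ofAssociativeRing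
  exact FreeLieAlgebra.lift_of_apply _ i

theorem freeLieToAssoc_lie (a b : FreeLieAlgebra K ι) :
    freeLieToAssoc K ι ⁅a, b⁆ = freeLieToAssoc K ι a * freeLieToAssoc K ι b
      - freeLieToAssoc K ι b * freeLieToAssoc K ι a := by
  let _ : LieRing (FreeAlgebra K ι) := LieRing.ofAssociativeRing
  exact LieHom.map_lie (FreeLieAlgebra.lift K (FreeAlgebra.ι K : ι → FreeAlgebra K ι)) a b

/-- The action of the free associative algebra on the direct sum of the free Lie algebra and the
scalars in which a generator `x` sends `(l, c)` to `([x, l] + c x, 0)`. The action on `(0, 1)` is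
the Dynkin operator. -/
noncomputable def dynkinAction (ι : Type*) :
    FreeAlgebra K ι →ₐ[K] Module.End K (FreeLieAlgebra K ι × K) :=
  FreeAlgebra.lift K fun i => LinearMap.inl K (FreeLieAlgebra K ι) K ∘ₗ
    (LieModule.toEnd K (FreeLieAlgebra K ι) (FreeLieAlgebra K ι) (FreeLieAlgebra.of K i)).coprod
      (LinearMap.toSpanSingleton K _ (FreeLieAlgebra.of K i))

/-- For a bracket, the part in `l` is the Jacobi identity, and the part in `c` is `[a, n b] - [b, m
a] = (m + n) [a, b]`. -/
theorem dynkinAction_lieMonomial {n : ℕ} {a : FreeLieAlgebra K ι}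
    (ha : IsLieMonomial (FreeLieAlgebra.of K) n a) (l : FreeLieAlgebra K ι) (c : K) :
    dynkinAction K ι (freeLieToAssoc K ι a) (l, c) = (⁅a, l⁆ + c • n • a, 0) := by
  induction ha generalizing l c with
  | gen i =>
    rw [freeLieToAssoc_of, dynkinAction, FreeAlgebra.lift_ι_apply]
    simp
  | @bracket m n a b _ _ ih₁ ih₂ =>
    rw [freeLieToAssoc_lie, map_sub, map_mul, map_mul, LinearMap.sub_apply, Module.End.mul_apply,
      Module.End.mul_apply, ih₁, ih₂, ih₁, ih₂, Prod.mk_sub_mk, zero_smul, zero_smul, add_zero,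
      add_zero, sub_zero]
    congr 1
    rw [lie_add, lie_add, lie_smul, lie_smul, lie_nsmul, lie_nsmul, lie_lie, add_smul,
      ← lie_skew b a]
    simp only [smul_add, smul_neg]
    abel

theorem dynkinAction_degreePiece {n : ℕ} {a : FreeLieAlgebra K ι}
    (ha : a ∈ degreePiece K (FreeLieAlgebra.of K) n) :
    dynkinAction K ι (freeLieToAssoc K ι a) (0, 1) = ((n : K) • a, 0) := by
  refine Submodule.span_induction (p := fun a _ =>
    dynkinAction K ι (freeLieToAssoc K ι a) (0, 1) = ((n : K) • a, 0)) ?_ ?_ ?_ ?_ ha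
  · intro a ha
    rw [dynkinAction_lieMonomial K ha]
    simp [Nat.cast_smul_eq_nsmul]
  · simp only [map_zero, LinearMap.zero_apply, smul_zero, Prod.mk_zero_zero]
  · intro a b _ _ h₁ h₂
    rw [map_add, map_add, LinearMap.add_apply, h₁, h₂]
    simp
  · intro c a _ h
    rw [map_smul, map_smul, LinearMap.smul_apply, h, Prod.smul_mk, smul_zero, smul_comm]

theorem IsLieMonomial.degree_pos {M ι : Type*} [LieRing M] {g : ι → M} {n : ℕ} {a : M}
    (h : IsLieMonomial g n a) : 0 < n := by
  induction h with
  | gen i => exact Nat.one_pos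
  | bracket _ _ h _ => omega

theorem degreePiece_zero {M ι : Type*} [LieRing M] [LieAlgebra K M] (g : ι → M) :
    degreePiece K g 0 = ⊥ := by
  rw [degreePiece, Submodule.span_eq_bot]
  intro a ha
  exact absurd (IsLieMonomial.degree_pos ha) (lt_irrefl 0)

end FreeLie

/-! ### The Hausdorff series is the image of a unique Lie series -/

section Hausdorff

open PowerSeries

variable (K : Type*) [Field K] [CharZero K]

/-- The Dynkin operator recovers `n a` from the image of `a`, which determines `a` in characteristic
zero when `n > 0`. The piece of degree `0` is trivial. -/
theorem freeLieToAssoc_injOn {ι : Type*} (n : ℕ) :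
    Set.InjOn (freeLieToAssoc K ι) (degreePiece K (FreeLieAlgebra.of K : ι → _) n) := by
  intro a ha b hb h
  rcases Nat.eq_zero_or_pos n with rfl | hn
  · rw [SetLike.mem_coe, degreePiece_zero, Submodule.mem_bot] at ha hb
    rw [ha, hb]
  · have h1 := dynkinAction_degreePiece K ha
    rw [h, dynkinAction_degreePiece K hb] at h1
    exact (smul_right_injective _ (Nat.cast_ne_zero.2 hn.ne') (Prod.mk.inj h1).1).symm

theorem toNCSeries_injective : Function.Injective (toNCSeries K) := by
  intro Z W h
  refine Subtype.ext (LieSeries.ext fun n => freeLieToAssoc_injOn K n (Z.2 n) (W.2 n) ?_)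
  have h1 := congrArg (fun P : ncSeries K (Fin 2) => PowerSeries.coeff n P.1) h
  simpa [toNCSeries] using h1

/-- The product `e^X e^Y` of non-commutative power series. -/
noncomputable def expMulExp : PowerSeries (FreeAlgebra K (Fin 2)) :=
  scalarSubst (exp K) (ncVar K 0).1 * scalarSubst (exp K) (ncVar K 1).1

/-- `ncSubst` and `scalarSubst` use the same truncated sum, so the calculus of `scalarSubst` applies
directly. -/
theorem coe_hausdorff : (hausdorff K).1 = scalarSubst (log K) (expMulExp K - 1) := rfl

omit [CharZero K] in
theorem coeff_ncVar {ι : Type*} (i : ι) (n : ℕ) :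
    coeff n (ncVar K i).1 = if n = 1 then FreeAlgebra.ι K i else 0 :=
  coeff_monomial n 1 _

theorem coeff_zero_expMulExp_sub_one : coeff 0 (expMulExp K - 1) = 0 := by
  rw [expMulExp, map_sub, coeff_mul, Finset.HasAntidiagonal.antidiagonal_zero, Finset.sum_singleton,
    coeff_zero_scalarSubst_exp, coeff_zero_scalarSubst_exp, coeff_zero_one, mul_one, sub_self]

theorem exp_hausdorff : scalarSubst (exp K) (hausdorff K).1 = expMulExp K := by
  have h0 := coeff_zero_expMulExp_sub_one K
  rw [coe_hausdorff, scalarSubst_scalarSubst _ (by simp) h0, scalarSubst_exp_log,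
    scalarSubst_add, scalarSubst_one _ h0, scalarSubst_X _ h0, add_sub_cancel]

theorem coeff_hausdorff_mem (n : ℕ) : coeff n (hausdorff K).1 ∈
    (degreePiece K (FreeLieAlgebra.of K) n).map (freeLieToAssoc K (Fin 2)) := by
  have hvar : ∀ i n, coeff n (ncVar K i).1 ∈
      (degreePiece K (FreeLieAlgebra.of K) n).map (freeLieToAssoc K (Fin 2)) := by
    intro i n
    rw [coeff_ncVar]
    split_ifs with h
    · subst h
      exact ⟨_, Submodule.subset_span (IsLieMonomial.gen i), freeLieToAssoc_of K i⟩
    · exact zero_mem _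
  refine coeff_mem_of_exp_eq_exp_mul_exp (P := (ncVar K 0).1) (Q := (ncVar K 1).1)
    (S := fun n => (degreePiece K (FreeLieAlgebra.of K) n).map (freeLieToAssoc K (Fin 2)))
    ?_ ?_ ?_ ?_ (hvar 0) (hvar 1) (exp_hausdorff K) n
  · rintro i j _ ⟨a, ha, rfl⟩ _ ⟨b, hb, rfl⟩
    exact ⟨⁅a, b⁆, lie_mem_degreePiece ha hb, freeLieToAssoc_lie K a b⟩
  · rw [coeff_ncVar, if_neg zero_ne_one]
  · rw [coeff_ncVar, if_neg zero_ne_one]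
  · rw [coe_hausdorff, coeff_zero_scalarSubst]
    simp

theorem existsUnique_toNCSeries_eq_hausdorff :
    ∃! Z : FreeLieCompletion K, toNCSeries K Z = hausdorff K := by
  choose a ha h using coeff_hausdorff_mem K
  refine ⟨⟨LieSeries.mk a, ha⟩, ?_, fun W hW => toNCSeries_injective K (hW.trans ?_)⟩
  all_goals
    refine Subtype.ext (PowerSeries.ext fun n => ?_)
    simp [toNCSeries, LieSeries.coeff_mk, h]

end Hausdorff

/-! ### The basis of the free metabelian Lie algebra -/

section Metabelian

open MvPowerSeries

variable (K : Type*) [Field K]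

/-- The lift of the generators to `N`, followed by the inclusion, fixes the generators and is
therefore the identity. -/
theorem mem_of_gens_mem {ι : Type*} (N : LieSubalgebra K (FreeLieAlgebra K ι))
    (h : ∀ i, FreeLieAlgebra.of K i ∈ N) (a : FreeLieAlgebra K ι) : a ∈ N := by
  have h1 : N.incl.comp (FreeLieAlgebra.lift K fun i => (⟨_, h i⟩ : N)) = LieHom.id :=
    FreeLieAlgebra.hom_ext fun i => by simp
  have h2 := LieHom.congr_fun h1 a
  rw [LieHom.id_apply] at h2
  rw [← h2]
  exact Subtype.property _

theorem metabelianMk_surjective : Function.Surjective (metabelianMk K) :=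
  LieSubmodule.Quotient.surjective_mk' _

theorem metabelianMk_eq_zero {a : FreeLieAlgebra K (Fin 2)} (h : a ∈ secondDerived K) :
    metabelianMk K a = 0 :=
  (LieSubmodule.Quotient.mk_eq_zero _).2 h

theorem mem_of_metabelianGen_mem (N : LieSubalgebra K (FreeMetabelian K))
    (h : ∀ i, metabelianGen K i ∈ N) (a : FreeMetabelian K) : a ∈ N := by
  obtain ⟨a, rfl⟩ := metabelianMk_surjective K a
  exact mem_of_gens_mem K (N.comap (metabelianMk K)) h a

theorem lie_lie_lie_eq_zero (a b c d : FreeMetabelian K) : ⁅⁅a, b⁆, ⁅c, d⁆⁆ = 0 := by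
  obtain ⟨a, rfl⟩ := metabelianMk_surjective K a
  obtain ⟨b, rfl⟩ := metabelianMk_surjective K b
  obtain ⟨c, rfl⟩ := metabelianMk_surjective K c
  obtain ⟨d, rfl⟩ := metabelianMk_surjective K d
  simp only [← LieHom.map_lie]
  exact metabelianMk_eq_zero K (LieSubmodule.lie_mem_lie
    (LieSubmodule.lie_mem_lie (LieSubmodule.mem_top a) (LieSubmodule.mem_top b))
    (LieSubmodule.lie_mem_lie (LieSubmodule.mem_top c) (LieSubmodule.mem_top d)))

/-- The element `[X^k Y^l X Y] = (ad X)^k (ad Y)^l [X, Y]`. -/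
noncomputable def bracketMonomial (k l : ℕ) : FreeMetabelian K :=
  (LieAlgebra.ad K (FreeMetabelian K) (metabelianGen K 0) ^ k)
    ((LieAlgebra.ad K (FreeMetabelian K) (metabelianGen K 1) ^ l)
      ⁅metabelianGen K 0, metabelianGen K 1⁆)

theorem bracketMonomial_zero_zero :
    bracketMonomial K 0 0 = ⁅metabelianGen K 0, metabelianGen K 1⁆ := rfl

theorem lie_zero_bracketMonomial (k l : ℕ) :
    ⁅metabelianGen K 0, bracketMonomial K k l⁆ = bracketMonomial K (k + 1) l := by
  rw [bracketMonomial, bracketMonomial, pow_succ', Module.End.mul_apply, LieAlgebra.ad_apply]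

theorem bracketMonomial_zero_succ (l : ℕ) :
    bracketMonomial K 0 (l + 1) = ⁅metabelianGen K 1, bracketMonomial K 0 l⁆ := by
  rw [bracketMonomial, bracketMonomial, pow_succ', Module.End.mul_apply, LieAlgebra.ad_apply]
  rfl

theorem exists_bracketMonomial_eq_lie (k l : ℕ) :
    ∃ a b : FreeMetabelian K, bracketMonomial K k l = ⁅a, b⁆ := by
  cases k with
  | succ k => exact ⟨_, _, (lie_zero_bracketMonomial K k l).symm⟩
  | zero =>
    cases l with
    | succ l => exact ⟨_, _, bracketMonomial_zero_succ K l⟩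
    | zero => exact ⟨_, _, bracketMonomial_zero_zero K⟩

/-- `Y` moves past `X` because the Leibniz correction `[[Y, X], c]` vanishes when `c` is itself a
bracket. -/
theorem lie_one_bracketMonomial (k l : ℕ) :
    ⁅metabelianGen K 1, bracketMonomial K k l⁆ = bracketMonomial K k (l + 1) := by
  induction k with
  | zero => rw [bracketMonomial_zero_succ]
  | succ k ih =>
    rw [← lie_zero_bracketMonomial, ← lie_zero_bracketMonomial, ← ih, leibniz_lie]
    obtain ⟨a, b, h⟩ := exists_bracketMonomial_eq_lie K k l
    rw [h, lie_lie_lie_eq_zero, zero_add]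

/-- The family `X`, `Y`, `[X^k Y^l X Y]`. -/
noncomputable def metabelianFamily : Fin 2 ⊕ ℕ × ℕ → FreeMetabelian K :=
  Sum.elim (metabelianGen K) fun p => bracketMonomial K p.1 p.2

theorem lie_gen_mem_span (i : Fin 2) (j : Fin 2 ⊕ ℕ × ℕ) :
    ⁅metabelianGen K i, metabelianFamily K j⁆ ∈
      Submodule.span K (Set.range (metabelianFamily K)) := by
  have hm : ∀ k l, bracketMonomial K k l ∈ Submodule.span K (Set.range (metabelianFamily K)) :=
    fun k l => Submodule.subset_span ⟨Sum.inr (k, l), rfl⟩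
  rcases j with j | ⟨k, l⟩
  · change ⁅metabelianGen K i, metabelianGen K j⁆ ∈ _
    fin_cases i <;> fin_cases j
    · simp
    · exact hm 0 0
    · rw [← lie_skew]
      exact neg_mem (hm 0 0)
    · simp
  · change ⁅metabelianGen K i, bracketMonomial K k l⁆ ∈ _
    fin_cases i
    · exact lie_zero_bracketMonomial K k l ▸ hm _ _
    · exact lie_one_bracketMonomial K k l ▸ hm _ _

/-- The elements whose `ad` preserves the span `V` form a Lie subalgebra containing the generators,
hence are everything. So `V` is a subalgebra containing the generators, hence is everything too. -/
theorem span_metabelianFamily : Submodule.span K (Set.range (metabelianFamily K)) = ⊤ := by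
  set V := Submodule.span K (Set.range (metabelianFamily K)) with hV
  have hgen : ∀ i, metabelianGen K i ∈ V := fun i => Submodule.subset_span ⟨Sum.inl i, rfl⟩
  have hideal : ∀ a : FreeMetabelian K, ∀ b ∈ V, ⁅a, b⁆ ∈ V := by
    let N : LieSubalgebra K (FreeMetabelian K) :=
      { carrier := {a | ∀ b ∈ V, ⁅a, b⁆ ∈ V}
        add_mem' := fun ha hb c hc => by
          rw [add_lie]
          exact V.add_mem (ha c hc) (hb c hc)
        zero_mem' := fun c _ => by
          rw [zero_lie]
          exact V.zero_mem
        smul_mem' := fun r a ha c hc => by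
          rw [smul_lie]
          exact V.smul_mem r (ha c hc)
        lie_mem' := fun ha hb c hc => by
          rw [lie_lie]
          exact V.sub_mem (ha _ (hb c hc)) (hb _ (ha c hc)) }
    refine mem_of_metabelianGen_mem K N fun i b hb => ?_
    refine Submodule.span_induction (p := fun b _ => ⁅metabelianGen K i, b⁆ ∈ V) ?_ ?_ ?_ ?_ hb
    · rintro _ ⟨j, rfl⟩
      exact lie_gen_mem_span K i j
    · rw [lie_zero]
      exact V.zero_mem
    · intro a b _ _ h₁ h₂
      rw [lie_add]
      exact V.add_mem h₁ h₂
    · intro r a _ h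
      rw [lie_smul]
      exact V.smul_mem r h
  exact eq_top_iff.2 fun a _ => mem_of_metabelianGen_mem K
    { V with lie_mem' := fun _ hb => hideal _ _ hb } hgen a

/-- The representation of the free associative algebra by affine transformations of the ring of
power series in `x` and `y`: `X` acts by `f ↦ x f + 1` and `Y` by `f ↦ y f` (as derivations of the
affine line, that is, with vanishing second row). -/
noncomputable def affineRep :
    FreeAlgebra K (Fin 2) →ₐ[K] Matrix (Fin 2) (Fin 2) (MvPowerSeries (Fin 2) K) :=
  FreeAlgebra.lift K ![!![X 0, 1; 0, 0], !![X 1, 0; 0, 0]]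

/-- The linear part of the affine transformation attached to a Lie element. -/
noncomputable def linearPart : FreeLieAlgebra K (Fin 2) →ₗ[K] MvPowerSeries (Fin 2) K :=
  Matrix.entryLinearMap K _ 0 0 ∘ₗ (affineRep K).toLinearMap ∘ₗ freeLieToAssoc K (Fin 2)

/-- The translation part of the affine transformation attached to a Lie element. -/
noncomputable def translationPart : FreeLieAlgebra K (Fin 2) →ₗ[K] MvPowerSeries (Fin 2) K :=
  Matrix.entryLinearMap K _ 0 1 ∘ₗ (affineRep K).toLinearMap ∘ₗ freeLieToAssoc K (Fin 2)

theorem linearPart_apply (a : FreeLieAlgebra K (Fin 2)) :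
    linearPart K a = affineRep K (freeLieToAssoc K (Fin 2) a) 0 0 := rfl

theorem translationPart_apply (a : FreeLieAlgebra K (Fin 2)) :
    translationPart K a = affineRep K (freeLieToAssoc K (Fin 2) a) 0 1 := rfl

theorem affineRep_lie (a b : FreeLieAlgebra K (Fin 2)) :
    affineRep K (freeLieToAssoc K (Fin 2) ⁅a, b⁆) =
      affineRep K (freeLieToAssoc K (Fin 2) a) * affineRep K (freeLieToAssoc K (Fin 2) b) -
      affineRep K (freeLieToAssoc K (Fin 2) b) * affineRep K (freeLieToAssoc K (Fin 2) a) := by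
  rw [freeLieToAssoc_lie, map_sub, map_mul, map_mul]

theorem affineRep_row_one (a : FreeLieAlgebra K (Fin 2)) (j : Fin 2) :
    affineRep K (freeLieToAssoc K (Fin 2) a) 1 j = 0 := by
  let N : LieSubalgebra K (FreeLieAlgebra K (Fin 2)) :=
    { carrier := {a | ∀ j, affineRep K (freeLieToAssoc K (Fin 2) a) 1 j = 0}
      add_mem' := fun ha hb j => by simp [ha j, hb j]
      zero_mem' := fun j => by simp
      smul_mem' := fun r a ha j => by simp [ha j]
      lie_mem' := fun {a b} ha hb j => by
        have ha : ∀ j, affineRep K (freeLieToAssoc K (Fin 2) a) 1 j = 0 := ha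
        have hb : ∀ j, affineRep K (freeLieToAssoc K (Fin 2) b) 1 j = 0 := hb
        rw [affineRep_lie, Matrix.sub_apply, Matrix.mul_apply, Matrix.mul_apply]
        simp [ha, hb] }
  refine mem_of_gens_mem K N (fun i j => ?_) a j
  rw [freeLieToAssoc_of, affineRep, FreeAlgebra.lift_ι_apply]
  fin_cases i <;> fin_cases j <;> rfl

theorem linearPart_lie (a b : FreeLieAlgebra K (Fin 2)) : linearPart K ⁅a, b⁆ = 0 := by
  rw [linearPart_apply, affineRep_lie, Matrix.sub_apply, Matrix.mul_apply, Matrix.mul_apply]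
  simp [affineRep_row_one, mul_comm]

theorem translationPart_lie (a b : FreeLieAlgebra K (Fin 2)) :
    translationPart K ⁅a, b⁆ =
      linearPart K a * translationPart K b - linearPart K b * translationPart K a := by
  rw [translationPart_apply, affineRep_lie, Matrix.sub_apply, Matrix.mul_apply, Matrix.mul_apply]
  simp [affineRep_row_one, linearPart_apply, translationPart_apply]

/-- Brackets have zero linear part, and a bracket of two elements with zero linear part has zero
translation part. -/
theorem secondDerived_vanish {a : FreeLieAlgebra K (Fin 2)} (ha : a ∈ secondDerived K) :
    linearPart K a = 0 ∧ translationPart K a = 0 := by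
  let J : LieIdeal K (FreeLieAlgebra K (Fin 2)) :=
    { LinearMap.ker (linearPart K) with lie_mem := fun {x a} _ => linearPart_lie K x a }
  have hJ : ⁅(⊤ : LieIdeal K (FreeLieAlgebra K (Fin 2))),
      (⊤ : LieIdeal K (FreeLieAlgebra K (Fin 2)))⁆ ≤ J :=
    (LieSubmodule.lie_le_iff _ _ _).2 fun x _ a _ => linearPart_lie K x a
  let J' : LieIdeal K (FreeLieAlgebra K (Fin 2)) :=
    { LinearMap.ker (linearPart K) ⊓ LinearMap.ker (translationPart K) with
      lie_mem := fun {x a} h => by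
        obtain ⟨h1, h2⟩ := h
        refine ⟨linearPart_lie K x a, ?_⟩
        change linearPart K a = 0 at h1
        change translationPart K a = 0 at h2
        change translationPart K _ = 0
        rw [translationPart_lie, h1, h2, mul_zero, zero_mul, sub_zero] }
  have hJ' : secondDerived K ≤ J' := (LieSubmodule.lie_le_iff _ _ _).2 fun x hx a ha => by
    refine ⟨linearPart_lie K x a, ?_⟩
    have h1 : linearPart K x = 0 := hJ hx
    have h2 : linearPart K a = 0 := hJ ha
    change translationPart K _ = 0
    rw [translationPart_lie, h1, h2, zero_mul, zero_mul, sub_zero]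
  exact hJ' ha

/-- The linear part, on the free metabelian Lie algebra. -/
noncomputable def metabelianLinear : FreeMetabelian K →ₗ[K] MvPowerSeries (Fin 2) K :=
  Submodule.liftQ (secondDerived K).toSubmodule (linearPart K)
    fun _ ha => (secondDerived_vanish K ha).1

/-- The translation part, on the free metabelian Lie algebra. -/
noncomputable def metabelianTranslation : FreeMetabelian K →ₗ[K] MvPowerSeries (Fin 2) K :=
  Submodule.liftQ (secondDerived K).toSubmodule (translationPart K)
    fun _ ha => (secondDerived_vanish K ha).2

theorem metabelianLinear_mk (a : FreeLieAlgebra K (Fin 2)) :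
    metabelianLinear K (metabelianMk K a) = linearPart K a := rfl

theorem metabelianTranslation_mk (a : FreeLieAlgebra K (Fin 2)) :
    metabelianTranslation K (metabelianMk K a) = translationPart K a := rfl

theorem metabelianLinear_lie (a b : FreeMetabelian K) : metabelianLinear K ⁅a, b⁆ = 0 := by
  obtain ⟨a, rfl⟩ := metabelianMk_surjective K a
  obtain ⟨b, rfl⟩ := metabelianMk_surjective K b
  rw [← LieHom.map_lie, metabelianLinear_mk, linearPart_lie]

theorem metabelianTranslation_lie (a b : FreeMetabelian K) :
    metabelianTranslation K ⁅a, b⁆ = metabelianLinear K a * metabelianTranslation K b -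
      metabelianLinear K b * metabelianTranslation K a := by
  obtain ⟨a, rfl⟩ := metabelianMk_surjective K a
  obtain ⟨b, rfl⟩ := metabelianMk_surjective K b
  rw [← LieHom.map_lie, metabelianTranslation_mk, translationPart_lie]
  rfl

theorem metabelianLinear_gen (i : Fin 2) : metabelianLinear K (metabelianGen K i) = X i := by
  rw [metabelianGen, metabelianLinear_mk, linearPart_apply, freeLieToAssoc_of, affineRep,
    FreeAlgebra.lift_ι_apply]
  fin_cases i <;> rfl

theorem metabelianTranslation_gen (i : Fin 2) :
    metabelianTranslation K (metabelianGen K i) = if i = 0 then 1 else 0 := by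
  rw [metabelianGen, metabelianTranslation_mk, translationPart_apply, freeLieToAssoc_of, affineRep,
    FreeAlgebra.lift_ι_apply]
  fin_cases i <;> rfl

theorem metabelianLinear_bracketMonomial (k l : ℕ) :
    metabelianLinear K (bracketMonomial K k l) = 0 := by
  obtain ⟨a, b, h⟩ := exists_bracketMonomial_eq_lie K k l
  rw [h, metabelianLinear_lie]

/-- `[X, Y]` translates by `-y`; on elements with zero linear part, `ad X` and `ad Y` multiply the
translation by `x` and `y`. This explains the sign and the exponent `l + 1` in `metabelianCoord`. -/
theorem metabelianTranslation_bracketMonomial (k l : ℕ) :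
    metabelianTranslation K (bracketMonomial K k l) = -(X 0 ^ k * X 1 ^ (l + 1)) := by
  induction k with
  | zero =>
    induction l with
    | zero =>
      rw [bracketMonomial_zero_zero, metabelianTranslation_lie, metabelianTranslation_gen,
        metabelianTranslation_gen, metabelianLinear_gen, metabelianLinear_gen]
      simp
    | succ l ih =>
      rw [bracketMonomial_zero_succ, metabelianTranslation_lie, ih, metabelianLinear_bracketMonomial,
        metabelianLinear_gen]
      ring
  | succ k ih =>
    rw [← lie_zero_bracketMonomial, metabelianTranslation_lie, ih, metabelianLinear_bracketMonomial,
      metabelianLinear_gen]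
    ring

/-- The coordinates with respect to the family `X`, `Y`, `[X^k Y^l X Y]`. -/
noncomputable def metabelianCoord (j : Fin 2 ⊕ ℕ × ℕ) : FreeMetabelian K →ₗ[K] K :=
  Sum.elim (fun i => coeff (Finsupp.single i 1) ∘ₗ metabelianLinear K)
    (fun p => -(coeff (Finsupp.single 0 p.1 + Finsupp.single 1 (p.2 + 1)) ∘ₗ
      metabelianTranslation K)) j

theorem X_pow_mul_X_pow (k l : ℕ) : (X 0 ^ k * X 1 ^ l : MvPowerSeries (Fin 2) K) =
    monomial (Finsupp.single 0 k + Finsupp.single 1 l) 1 := by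
  rw [X_pow_eq, X_pow_eq, monomial_mul_monomial, one_mul]

theorem single_add_single_inj {k l k' l' : ℕ} :
    (Finsupp.single 0 k + Finsupp.single 1 l : Fin 2 →₀ ℕ) =
      Finsupp.single 0 k' + Finsupp.single 1 l' ↔ k = k' ∧ l = l' := by
  constructor
  · intro h
    have h0 := DFunLike.congr_fun h 0
    have h1 := DFunLike.congr_fun h 1
    simp at h0 h1
    exact ⟨h0, h1⟩
  · rintro ⟨rfl, rfl⟩
    rfl

theorem metabelianCoord_family (i j : Fin 2 ⊕ ℕ × ℕ) :
    metabelianCoord K i (metabelianFamily K j) = if i = j then 1 else 0 := by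
  classical
  rcases i with i | ⟨k, l⟩ <;> rcases j with j | ⟨k', l'⟩
  · change coeff _ (metabelianLinear K (metabelianGen K j)) = _
    rw [metabelianLinear_gen, coeff_X]
    simp [Finsupp.single_left_inj]
  · change coeff _ (metabelianLinear K (bracketMonomial K k' l')) = _
    rw [metabelianLinear_bracketMonomial]
    simp
  · change -coeff (Finsupp.single 0 k + Finsupp.single 1 (l + 1))
      (metabelianTranslation K (metabelianGen K j)) = 0
    have h : (Finsupp.single 0 k + Finsupp.single 1 (l + 1) : Fin 2 →₀ ℕ) ≠ 0 := fun h => by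
      simpa using DFunLike.congr_fun h 1
    rw [metabelianTranslation_gen]
    split_ifs
    · rw [coeff_one, if_neg h, neg_zero]
    · rw [map_zero, neg_zero]
  · change -coeff (Finsupp.single 0 k + Finsupp.single 1 (l + 1))
      (metabelianTranslation K (bracketMonomial K k' l')) = _
    rw [metabelianTranslation_bracketMonomial, X_pow_mul_X_pow, map_neg, neg_neg, coeff_monomial]
    simp only [single_add_single_inj, Nat.add_right_cancel_iff, Sum.inr.injEq, Prod.mk.injEq]

theorem linearIndependent_metabelianFamily : LinearIndependent K (metabelianFamily K) :=
  LinearIndependent.of_pairwise_dual_eq_zero_one _ (metabelianCoord K)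
    (fun i j h => (metabelianCoord_family K i j).trans (if_neg h))
    (fun i => (metabelianCoord_family K i i).trans (if_pos rfl))

/-- The basis `X`, `Y`, `[X^k Y^l X Y]` of the free metabelian Lie algebra. -/
noncomputable def metabelianBasis : Module.Basis (Fin 2 ⊕ ℕ × ℕ) K (FreeMetabelian K) :=
  Module.Basis.mk (linearIndependent_metabelianFamily K) (span_metabelianFamily K).ge

theorem metabelianBasis_apply (j : Fin 2 ⊕ ℕ × ℕ) : metabelianBasis K j = metabelianFamily K j :=
  Module.Basis.mk_apply _ _ j

/-- All coordinates in the basis are coefficients of these two parts. This reduces the formula for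
the image of `H` to two commutative computations. -/
theorem eq_of_linear_eq_of_translation_eq {a b : FreeMetabelian K}
    (h1 : metabelianLinear K a = metabelianLinear K b)
    (h2 : metabelianTranslation K a = metabelianTranslation K b) : a = b := by
  have h : ∀ j, metabelianCoord K j = (metabelianBasis K).coord j := fun j =>
    (metabelianBasis K).ext fun i => by
      rw [metabelianBasis_apply, metabelianCoord_family, Module.Basis.coord_apply,
        ← metabelianBasis_apply, Module.Basis.repr_self, Finsupp.single_apply]
      simp [eq_comm]
  refine (metabelianBasis K).ext_elem fun j => ?_
  rw [← Module.Basis.coord_apply, ← Module.Basis.coord_apply, ← h]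
  rcases j with i | p
  · exact congrArg (coeff (Finsupp.single i 1)) h1
  · exact congrArg (fun F => -coeff (Finsupp.single 0 p.1 + Finsupp.single 1 (p.2 + 1)) F) h2

end Metabelian

/-! ### Recording the degree of commutative series by a variable `t` -/

section Homogenization

open PowerSeries Finset

variable {K : Type*} [Field K] {σ : Type*}

theorem isHomogeneous_pow {a : MvPowerSeries σ K} (ha : a.IsHomogeneous 1) (n : ℕ) :
    (a ^ n).IsHomogeneous n := by
  induction n with
  | zero =>
    classical
    intro d hd
    rw [pow_zero, MvPowerSeries.coeff_one] at hd
    have : d = 0 := by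
      by_contra h
      exact hd (if_neg h)
    rw [this, map_zero]
  | succ n ih =>
    rw [pow_succ]
    exact ih.mul ha

theorem isHomogeneous_X (i : σ) : (MvPowerSeries.X i : MvPowerSeries σ K).IsHomogeneous 1 := by
  classical
  intro d hd
  rw [MvPowerSeries.coeff_X] at hd
  have : d = Finsupp.single i 1 := by
    by_contra h
    exact hd (if_neg h)
  rw [this]
  simp [Finsupp.weight_single]

theorem hasSubst_of_isHomogeneous {a : MvPowerSeries σ K} (ha : a.IsHomogeneous 1) :
    HasSubst a :=
  HasSubst.of_constantCoeff_zero (by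
    rw [← MvPowerSeries.coeff_zero_eq_constantCoeff_apply]
    exact ha.coeff_eq_zero (by simp))

/-- `a ^ n` is homogeneous of degree `n`, so a single power contributes to each monomial. -/
theorem coeff_subst_of_isHomogeneous {a : MvPowerSeries σ K} (ha : a.IsHomogeneous 1)
    (F : PowerSeries K) (d : σ →₀ ℕ) : MvPowerSeries.coeff d (F.subst a) =
      coeff d.degree F * MvPowerSeries.coeff d (a ^ d.degree) := by
  rw [coeff_subst (hasSubst_of_isHomogeneous ha), finsum_eq_single _ d.degree, smul_eq_mul]
  intro n hn
  rw [MvPowerSeries.IsHomogeneous.coeff_eq_zero (isHomogeneous_pow ha n) hn.symm, smul_zero]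

/-- The ring homomorphism `F(x, y, …) ↦ F(x t, y t, …)`, where `t` is a new variable. -/
noncomputable def homogenize : MvPowerSeries σ K →+* PowerSeries (MvPowerSeries σ K) where
  toFun F := PowerSeries.mk fun n => MvPowerSeries.homogeneousComponent n F
  map_one' := by
    classical
    ext n d
    rw [coeff_mk, MvPowerSeries.coeff_homogeneousComponent, coeff_one, MvPowerSeries.coeff_one]
    by_cases hd : d = 0
    · subst hd
      by_cases hn : n = 0
      · simp [hn]
      · simp [hn, Ne.symm hn]
    · split_ifs <;> simp [MvPowerSeries.coeff_one, hd]
  map_zero' := by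
    ext n
    simp
  map_add' F G := by
    ext n
    simp
  map_mul' F G := by
    classical
    ext n d
    rw [coeff_mk, MvPowerSeries.coeff_homogeneousComponent, coeff_mul, map_sum]
    simp only [coeff_mk, MvPowerSeries.coeff_mul, MvPowerSeries.coeff_homogeneousComponent]
    rw [sum_comm]
    trans ∑ p ∈ antidiagonal d, if d.degree = n then
      MvPowerSeries.coeff p.1 F * MvPowerSeries.coeff p.2 G else 0
    · split_ifs <;> simp
    refine sum_congr rfl fun p hp => ?_
    have hd : p.1.degree + p.2.degree = d.degree := by rw [← map_add, mem_antidiagonal.1 hp]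
    split_ifs with h
    · rw [sum_eq_single (p.1.degree, p.2.degree)]
      · simp
      · rintro ⟨i, j⟩ _ hne
        rw [Ne, Prod.mk.injEq, not_and_or] at hne
        rcases hne with hne | hne
        · rw [if_neg (Ne.symm hne), zero_mul]
        · rw [if_neg (Ne.symm hne), mul_zero]
      · intro hne
        exact absurd (mem_antidiagonal.2 (hd.trans h)) hne
    · refine (sum_eq_zero fun q hq => ?_).symm
      by_cases h1 : p.1.degree = q.1
      · have h2 : p.2.degree ≠ q.2 := fun h2 =>
          h (by rw [← hd, h1, h2, mem_antidiagonal.1 hq])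
        rw [if_neg h2, mul_zero]
      · rw [if_neg h1, zero_mul]

theorem coeff_homogenize (F : MvPowerSeries σ K) (n : ℕ) :
    coeff n (homogenize F) = MvPowerSeries.homogeneousComponent n F :=
  coeff_mk n fun n => MvPowerSeries.homogeneousComponent n F

/-- The ring homomorphism `F(t) ↦ F(a t)` from power series in `t` with scalar coefficients. -/
noncomputable def substScaled (a : MvPowerSeries σ K) :
    PowerSeries K →+* PowerSeries (MvPowerSeries σ K) :=
  (rescale a).comp (PowerSeries.map (algebraMap K (MvPowerSeries σ K)))

theorem coeff_substScaled (a : MvPowerSeries σ K) (F : PowerSeries K) (n : ℕ) :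
    coeff n (substScaled a F) = coeff n F • a ^ n := by
  rw [substScaled, RingHom.comp_apply, coeff_rescale, coeff_map, Algebra.smul_def, mul_comm]

theorem homogenize_subst {a : MvPowerSeries σ K} (ha : a.IsHomogeneous 1) (F : PowerSeries K) :
    homogenize (F.subst a) = substScaled a F := by
  ext n d
  rw [coeff_homogenize, coeff_substScaled, MvPowerSeries.coeff_homogeneousComponent,
    coeff_subst_of_isHomogeneous ha, map_smul, smul_eq_mul]
  split_ifs with h
  · rw [h]
  · rw [MvPowerSeries.IsHomogeneous.coeff_eq_zero (isHomogeneous_pow ha n) h, mul_zero]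

theorem substScaled_X (a : MvPowerSeries σ K) : substScaled a X = C a * X := by
  rw [substScaled, RingHom.comp_apply, map_X, rescale_X]

theorem scalarSubst_substScaled (a : MvPowerSeries σ K) (F P : PowerSeries K) :
    scalarSubst F (substScaled a P) = substScaled a (scalarSubst F P) := by
  ext n : 1
  rw [coeff_substScaled, scalarSubst, scalarSubst, seriesSum, seriesSum, coeff_mk, coeff_mk,
    sum_smul]
  refine sum_congr rfl fun m _ => ?_
  rw [← map_pow]
  change coeff m F • coeff n (substScaled a (P ^ m)) = (coeff m F • coeff n (P ^ m)) • a ^ n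
  rw [coeff_substScaled, smul_smul, smul_eq_mul]

theorem substScaled_exp_mul [CharZero K] (a b : MvPowerSeries σ K) :
    substScaled a (exp K) * substScaled b (exp K) = substScaled (a + b) (exp K) := by
  simp only [substScaled, RingHom.comp_apply, map_exp, exp_mul_exp_eq_exp_add]

end Homogenization

/-! ### The power series `h` -/

section CoefficientFunction

open MvPowerSeries

variable (K : Type*) [Field K] [CharZero K]

/-- The series `(e^t - 1) / t`. -/
noncomputable def expQuotient : PowerSeries K :=
  PowerSeries.mk fun n => PowerSeries.coeff (n + 1) (PowerSeries.exp K)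

theorem X_mul_expQuotient : PowerSeries.X * expQuotient K = PowerSeries.exp K - 1 := by
  ext n
  cases n with
  | zero => simp
  | succ n =>
    rw [PowerSeries.coeff_succ_X_mul, expQuotient, PowerSeries.coeff_mk, map_sub,
      PowerSeries.coeff_one, if_neg n.succ_ne_zero, sub_zero]

theorem coeff_zero_expQuotient : PowerSeries.coeff 0 (expQuotient K) = 1 := by
  simp [expQuotient, PowerSeries.coeff_exp]

variable {K}

theorem commExp_sub_one {a : MvPowerSeries (Fin 2) K} (ha : a.IsHomogeneous 1) :
    commExp a - 1 = a * (expQuotient K).subst a := by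
  have hs := hasSubst_of_isHomogeneous ha
  have h := congrArg (fun F : PowerSeries K => F.subst a) (X_mul_expQuotient K)
  simp only [PowerSeries.subst_mul hs, PowerSeries.subst_X hs, PowerSeries.subst_sub hs] at h
  rw [h, commExp, ← PowerSeries.coe_substAlgHom hs, map_one]

variable (K)

omit [CharZero K] in
theorem isHomogeneous_X_add_X : (X 0 + X 1 : MvPowerSeries (Fin 2) K).IsHomogeneous 1 :=
  IsHomogeneous.add (isHomogeneous_X 0) (isHomogeneous_X 1)

/-- Each `(x + y)^n - x^n` is divisible by `(x + y) - x = y`. -/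
theorem X_one_dvd_subst_sub : (X 1 : MvPowerSeries (Fin 2) K) ∣
    (expQuotient K).subst (X 0 + X 1 : MvPowerSeries (Fin 2) K) - (expQuotient K).subst (X 0) := by
  rw [X_dvd_iff]
  intro d hd
  rw [map_sub, coeff_subst_of_isHomogeneous (isHomogeneous_X_add_X K),
    coeff_subst_of_isHomogeneous (isHomogeneous_X 0), ← mul_sub, ← map_sub]
  have h := sub_dvd_pow_sub_pow (X 0 + X 1 : MvPowerSeries (Fin 2) K) (X 0) d.degree
  rw [add_sub_cancel_left, X_dvd_iff] at h
  rw [h d hd, mul_zero]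

theorem isUnit_subst_expQuotient {a : MvPowerSeries (Fin 2) K} (ha : a.IsHomogeneous 1) :
    IsUnit ((expQuotient K).subst a) := by
  rw [MvPowerSeries.isUnit_iff_constantCoeff, ← coeff_zero_eq_constantCoeff_apply,
    coeff_subst_of_isHomogeneous ha]
  simp only [map_zero, pow_zero, coeff_zero_one, mul_one]
  rw [coeff_zero_expQuotient]
  exact isUnit_one

/-- The defining fraction with denominators cleared, `y h q(x+y) = q(x+y) - q(x)`. It is solvable
because `y` divides the right side and `q(x+y)` has constant term `1`. -/
theorem exists_coefficientFunction : ∃ h : MvPowerSeries (Fin 2) K,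
    X 1 * h * (expQuotient K).subst (X 0 + X 1 : MvPowerSeries (Fin 2) K) =
      (expQuotient K).subst (X 0 + X 1 : MvPowerSeries (Fin 2) K) -
        (expQuotient K).subst (X 0) := by
  obtain ⟨g, hg⟩ := X_one_dvd_subst_sub K
  obtain ⟨u, hu⟩ := isUnit_subst_expQuotient K (isHomogeneous_X_add_X K)
  refine ⟨g * ↑u⁻¹, ?_⟩
  rw [hg, ← hu, mul_assoc, mul_assoc, Units.inv_mul, mul_one]

omit [CharZero K] in
theorem X_add_X_ne_zero : (X 0 + X 1 : MvPowerSeries (Fin 2) K) ≠ 0 := by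
  intro h
  have h1 := congrArg (coeff (Finsupp.single 0 1)) h
  rw [map_add, coeff_X, coeff_X, if_pos rfl, map_zero,
    if_neg (by simp [Finsupp.single_left_inj])] at h1
  simp at h1

omit [CharZero K] in
theorem X_ne_zero (i : Fin 2) : (X i : MvPowerSeries (Fin 2) K) ≠ 0 := by
  intro h
  have h1 := congrArg (coeff (Finsupp.single i 1)) h
  rw [coeff_X, if_pos rfl, map_zero] at h1
  exact one_ne_zero h1

theorem algebraMap_eq_metabelianFraction {h : MvPowerSeries (Fin 2) K}
    (hh : X 1 * h * (expQuotient K).subst (X 0 + X 1 : MvPowerSeries (Fin 2) K) =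
      (expQuotient K).subst (X 0 + X 1 : MvPowerSeries (Fin 2) K) -
        (expQuotient K).subst (X 0)) :
    algebraMap (MvPowerSeries (Fin 2) K) (SeriesFractions K) h = metabelianFraction K := by
  have hc : ∀ {a : MvPowerSeries (Fin 2) K}, a ≠ 0 →
      algebraMap (MvPowerSeries (Fin 2) K) (SeriesFractions K) a ≠ 0 := fun ha =>
    (map_ne_zero_iff _ (IsFractionRing.injective _ _)).2 ha
  have hx := hc (X_ne_zero K 0)
  have hy := hc (X_ne_zero K 1)
  have hs := hc (X_add_X_ne_zero K)
  have hq := hc (isUnit_subst_expQuotient K (isHomogeneous_X_add_X K)).ne_zero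
  rw [metabelianFraction]
  rw [← map_one (algebraMap (MvPowerSeries (Fin 2) K) (SeriesFractions K)), ← map_sub, ← map_sub,
    commExp_sub_one (isHomogeneous_X 0), commExp_sub_one (isHomogeneous_X_add_X K)]
  have hh := congrArg (algebraMap (MvPowerSeries (Fin 2) K) (SeriesFractions K)) hh
  simp only [map_mul, map_sub, map_one] at hh ⊢
  field_simp
  linear_combination hh

end CoefficientFunction

/-! ### Matrix entries of the Hausdorff series -/

section Entries

open PowerSeries Finset

variable (K : Type*) [Field K]

/-- The series formed by the `(i, j)` entries of the images under `affineRep` of the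
coefficients. -/
noncomputable def entrySeries (i j : Fin 2) (P : PowerSeries (FreeAlgebra K (Fin 2))) :
    PowerSeries (MvPowerSeries (Fin 2) K) :=
  PowerSeries.mk fun n => affineRep K (coeff n P) i j

theorem coeff_entrySeries (i j : Fin 2) (P : PowerSeries (FreeAlgebra K (Fin 2))) (n : ℕ) :
    coeff n (entrySeries K i j P) = affineRep K (coeff n P) i j :=
  coeff_mk _ _

theorem entrySeries_sub (i j : Fin 2) (P Q : PowerSeries (FreeAlgebra K (Fin 2))) :
    entrySeries K i j (P - Q) = entrySeries K i j P - entrySeries K i j Q := by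
  ext n : 1
  simp only [coeff_entrySeries, map_sub, Matrix.sub_apply]

theorem entrySeries_one (i j : Fin 2) : entrySeries K i j 1 = if i = j then 1 else 0 := by
  ext n : 1
  rw [coeff_entrySeries, coeff_one]
  split_ifs with h1 h2 h2 <;> simp [coeff_one, h1, h2]

theorem entrySeries_mul (i j : Fin 2) (P Q : PowerSeries (FreeAlgebra K (Fin 2))) :
    entrySeries K i j (P * Q) = entrySeries K i 0 P * entrySeries K 0 j Q +
      entrySeries K i 1 P * entrySeries K 1 j Q := by
  ext n : 1
  simp only [coeff_entrySeries, map_add, coeff_mul, map_sum, Matrix.sum_apply, map_mul,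
    Matrix.mul_apply, Fin.sum_univ_two, sum_add_distrib]

/-- When the lower left entry vanishes, the upper left entry of a power is the power of the upper
left entry. -/
theorem entrySeries_zero_zero_scalarSubst (F : PowerSeries K)
    {P : PowerSeries (FreeAlgebra K (Fin 2))} (hP : entrySeries K 1 0 P = 0) :
    entrySeries K 0 0 (scalarSubst F P) = scalarSubst F (entrySeries K 0 0 P) := by
  have h : ∀ m, entrySeries K 0 0 (P ^ m) = entrySeries K 0 0 P ^ m := by
    intro m
    induction m with
    | zero => rw [pow_zero, pow_zero, entrySeries_one, if_pos rfl]
    | succ m ih => rw [pow_succ, pow_succ, entrySeries_mul, ih, hP, mul_zero, add_zero]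
  ext n : 1
  rw [coeff_entrySeries, scalarSubst, scalarSubst, seriesSum, seriesSum, coeff_mk, coeff_mk,
    map_sum, Matrix.sum_apply]
  refine sum_congr rfl fun m _ => ?_
  rw [← h]
  change affineRep K (coeff m F • coeff n (P ^ m)) 0 0 =
    coeff m F • coeff n (entrySeries K 0 0 (P ^ m))
  rw [map_smul, Matrix.smul_apply, coeff_entrySeries]

variable [CharZero K]

theorem coeff_entrySeries_exp (i j k : Fin 2) (n : ℕ) :
    coeff n (entrySeries K i j (scalarSubst (exp K) (ncVar K k).1)) =
      coeff n (exp K) • (affineRep K (FreeAlgebra.ι K k) ^ n) i j := by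
  have h : ∀ m, coeff n ((ncVar K k).1 ^ m) =
      if n = m then FreeAlgebra.ι K k ^ m else 0 := by
    intro m
    have hm : (ncVar K k).1 ^ m = PowerSeries.monomial m (FreeAlgebra.ι K k ^ m) := by
      induction m with
      | zero => rw [pow_zero, pow_zero, monomial_zero_eq_C_apply, map_one]
      | succ m ih =>
        rw [pow_succ, pow_succ, ih]
        exact monomial_mul_monomial m 1 _ _
    rw [hm, coeff_monomial]
  rw [coeff_entrySeries, coeff_scalarSubst _ (by simp [coeff_ncVar]) (Nat.lt_succ_self n)]
  simp only [h, smul_ite, smul_zero]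
  rw [sum_ite_eq, if_pos (mem_range.2 n.lt_succ_self), map_smul, map_pow, Matrix.smul_apply]

omit [CharZero K] in
theorem affineRep_pow_succ (k : Fin 2) (n : ℕ) :
    affineRep K (FreeAlgebra.ι K k) ^ (n + 1) =
      !![MvPowerSeries.X k ^ (n + 1), if k = 0 then MvPowerSeries.X k ^ n else 0; 0, 0] := by
  have h1 : affineRep K (FreeAlgebra.ι K k) =
      !![MvPowerSeries.X k, if k = 0 then 1 else 0; 0, 0] := by
    rw [affineRep, FreeAlgebra.lift_ι_apply]
    fin_cases k <;> rfl
  induction n with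
  | zero => rw [zero_add, pow_one, pow_one, pow_zero, h1]
  | succ n ih =>
    rw [pow_succ', ih, h1]
    ext i j
    fin_cases i <;> fin_cases j <;> simp [Matrix.mul_apply, Fin.sum_univ_two, pow_succ']

theorem entrySeries_exp_zero_zero (k : Fin 2) :
    entrySeries K 0 0 (scalarSubst (exp K) (ncVar K k).1) =
      substScaled (MvPowerSeries.X k) (exp K) := by
  ext n : 1
  rw [coeff_entrySeries_exp, coeff_substScaled]
  cases n with
  | zero => simp
  | succ n => rw [affineRep_pow_succ]; rfl

/-- The matrix of `X` to the power `n + 1` has translation entry `x^n`, so the sum is `∑ x^n t^(n+1)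
/ (n+1)! = t q(xt)`; powers of `Y` do not translate. -/
theorem entrySeries_exp_zero_one (k : Fin 2) :
    entrySeries K 0 1 (scalarSubst (exp K) (ncVar K k).1) =
      if k = 0 then X * substScaled (MvPowerSeries.X k) (expQuotient K) else 0 := by
  ext n : 1
  rw [coeff_entrySeries_exp]
  cases n with
  | zero => split_ifs <;> simp
  | succ n =>
    rw [affineRep_pow_succ]
    split_ifs with h
    · rw [coeff_succ_X_mul, coeff_substScaled, expQuotient, coeff_mk]
      rfl
    · rw [map_zero]
      exact smul_zero _

theorem entrySeries_exp_one (j k : Fin 2) :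
    entrySeries K 1 j (scalarSubst (exp K) (ncVar K k).1) = if j = 1 then 1 else 0 := by
  ext n : 1
  rw [coeff_entrySeries_exp]
  cases n with
  | zero => fin_cases j <;> simp
  | succ n =>
    rw [affineRep_pow_succ]
    fin_cases j <;> simp [coeff_one]

theorem entrySeries_expMulExp_sub_one_zero_zero :
    entrySeries K 0 0 (expMulExp K - 1) =
      substScaled (MvPowerSeries.X 0 + MvPowerSeries.X 1) (exp K - 1) := by
  rw [entrySeries_sub, entrySeries_one, if_pos rfl, expMulExp, entrySeries_mul,
    entrySeries_exp_zero_zero, entrySeries_exp_zero_zero, entrySeries_exp_one, if_neg zero_ne_one,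
    mul_zero, add_zero, substScaled_exp_mul, map_sub, map_one]

theorem entrySeries_expMulExp_sub_one_zero_one :
    entrySeries K 0 1 (expMulExp K - 1) =
      X * substScaled (MvPowerSeries.X 0) (expQuotient K) := by
  rw [entrySeries_sub, entrySeries_one, if_neg zero_ne_one, expMulExp, entrySeries_mul,
    entrySeries_exp_zero_one, entrySeries_exp_zero_one, entrySeries_exp_one, if_neg one_ne_zero,
    if_pos rfl, if_pos rfl, mul_zero, zero_add, mul_one, sub_zero]

theorem entrySeries_expMulExp_sub_one_one (j : Fin 2) :
    entrySeries K 1 j (expMulExp K - 1) = 0 := by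
  rw [entrySeries_sub, entrySeries_one, expMulExp, entrySeries_mul, entrySeries_exp_one,
    entrySeries_exp_one, entrySeries_exp_one]
  fin_cases j <;> simp

theorem entrySeries_hausdorff_zero_zero :
    entrySeries K 0 0 (hausdorff K).1 = C (MvPowerSeries.X 0 + MvPowerSeries.X 1) * X := by
  rw [coe_hausdorff, entrySeries_zero_zero_scalarSubst K _ (entrySeries_expMulExp_sub_one_one K 0),
    entrySeries_expMulExp_sub_one_zero_zero, scalarSubst_substScaled, scalarSubst_log_exp_sub_one,
    substScaled_X]

/-- Proportionality of first rows: writing `log(1 + u) = L(u) u` gives `H = L(M) M` with `M = e^X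
e^Y - 1`, and the second row of `M` is zero. So both entries of `H` are those of `M` times one
factor, which the known linear part `s t` identifies as `1 / q(st)`. -/
theorem entrySeries_hausdorff_zero_one_mul :
    entrySeries K 0 1 (hausdorff K).1 *
        substScaled (MvPowerSeries.X 0 + MvPowerSeries.X 1) (expQuotient K) =
      X * substScaled (MvPowerSeries.X 0) (expQuotient K) := by
  set s : MvPowerSeries (Fin 2) K := MvPowerSeries.X 0 + MvPowerSeries.X 1 with hs
  have h0 := coeff_zero_expMulExp_sub_one K
  have hlog : log K = PowerSeries.mk (fun n => coeff (n + 1) (log K)) * X := by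
    ext n
    cases n with
    | zero => simp
    | succ n => rw [coeff_succ_mul_X, coeff_mk]
  have hH : ∀ j, entrySeries K 0 j (hausdorff K).1 = entrySeries K 0 0
      (scalarSubst (PowerSeries.mk fun n => coeff (n + 1) (log K)) (expMulExp K - 1)) *
        entrySeries K 0 j (expMulExp K - 1) := by
    intro j
    rw [coe_hausdorff]
    conv_lhs => rw [hlog]
    rw [scalarSubst_mul _ _ h0, scalarSubst_X _ h0, entrySeries_mul,
      entrySeries_expMulExp_sub_one_one, mul_zero, add_zero]
  have h00 := hH 0
  have h01 := hH 1
  rw [entrySeries_hausdorff_zero_zero, entrySeries_expMulExp_sub_one_zero_zero,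
    ← X_mul_expQuotient, map_mul, substScaled_X, ← hs] at h00
  rw [entrySeries_expMulExp_sub_one_zero_one] at h01
  -- Multiplying the goal by `s t` lets the linear entry eliminate the unknown common factor.
  have hne : (C s * X : PowerSeries (MvPowerSeries (Fin 2) K)) ≠ 0 :=
    mul_ne_zero (fun h => X_add_X_ne_zero K (C_injective (h.trans (map_zero C).symm)))
      PowerSeries.X_ne_zero
  refine mul_left_cancel₀ hne ?_
  rw [h01]
  linear_combination (-(X * substScaled (MvPowerSeries.X 0) (expQuotient K))) * h00

/-- Homogenizing the equation for `h` gives `y t h(xt, yt) q(st) = q(st) - q(xt)`; comparison with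
the preceding identity follows after cancelling `q(st) ≠ 0`. -/
theorem entrySeries_hausdorff_zero_one {h : MvPowerSeries (Fin 2) K}
    (hh : MvPowerSeries.X 1 * h *
        (expQuotient K).subst (MvPowerSeries.X 0 + MvPowerSeries.X 1 : MvPowerSeries (Fin 2) K) =
      (expQuotient K).subst (MvPowerSeries.X 0 + MvPowerSeries.X 1 : MvPowerSeries (Fin 2) K) -
        (expQuotient K).subst (MvPowerSeries.X 0)) :
    entrySeries K 0 1 (hausdorff K).1 =
      X - C (MvPowerSeries.X 1) * (X * (X * homogenize h)) := by
  have hy : homogenize (MvPowerSeries.X 1 : MvPowerSeries (Fin 2) K) =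
      C (MvPowerSeries.X 1) * X := by
    rw [← substScaled_X, ← homogenize_subst (isHomogeneous_X 1),
      subst_X (hasSubst_of_isHomogeneous (isHomogeneous_X 1))]
  have h1 := congrArg homogenize hh
  rw [map_mul, map_mul, map_sub, homogenize_subst (isHomogeneous_X_add_X K),
    homogenize_subst (isHomogeneous_X 0), hy] at h1
  have hne : substScaled (MvPowerSeries.X 0 + MvPowerSeries.X 1 : MvPowerSeries (Fin 2) K)
      (expQuotient K) ≠ 0 := by
    intro h0
    have h2 := congrArg (coeff 0) h0
    rw [coeff_substScaled, coeff_zero_expQuotient, pow_zero, one_smul, map_zero] at h2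
    exact one_ne_zero h2
  refine mul_right_cancel₀ hne ?_
  rw [entrySeries_hausdorff_zero_one_mul]
  linear_combination X * h1

end Entries

/-! ### Comparison in the completed metabelian algebra -/

section Completion

open Finset

theorem coeff_lie_gen {K M ι : Type*} [CommRing K] [LieRing M] [LieAlgebra K M] (g : ι → M)
    (i : ι) (f : gradedCompletion K g) (n : ℕ) :
    LieSeries.coeff n ⁅gen K g i, f⁆.1 =
      if n = 0 then 0 else ⁅g i, LieSeries.coeff (n - 1) f.1⁆ := by
  change ∑ p ∈ HasAntidiagonal.antidiagonal n,
    ⁅(if p.1 = 1 then g i else 0), LieSeries.coeff p.2 f.1⁆ = _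
  split_ifs with hn
  · subst hn
    simp
  · rw [sum_eq_single (1, n - 1)]
    · rw [if_pos rfl]
    · rintro ⟨a, b⟩ hab hne
      have hab : a + b = n := HasAntidiagonal.mem_antidiagonal.1 hab
      rw [if_neg, zero_lie]
      rintro rfl
      exact hne (by rw [Prod.mk.injEq]; exact ⟨rfl, by omega⟩)
    · intro h
      exact absurd (HasAntidiagonal.mem_antidiagonal.2 (by simp only; omega)) h

theorem coeff_gen {K M ι : Type*} [CommRing K] [LieRing M] [LieAlgebra K M] (g : ι → M)
    (i : ι) (n : ℕ) : LieSeries.coeff n (gen K g i).1 = if n = 1 then g i else 0 := rfl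

variable (K : Type*) [Field K]

theorem coeff_adMonomial (k l n : ℕ) :
    LieSeries.coeff n (adMonomial (metabelianGen K) k l
      ⁅gen K (metabelianGen K) 0, gen K (metabelianGen K) 1⁆).1 =
        if n = k + l + 2 then bracketMonomial K k l else 0 := by
  induction k generalizing n with
  | zero =>
    induction l generalizing n with
    | zero =>
      change LieSeries.coeff n
        ⁅gen K (metabelianGen K) 0, gen K (metabelianGen K) 1⁆.1 = _
      rw [coeff_lie_gen, coeff_gen]
      split_ifs <;> first | omega | rfl | simp
    | succ l ih =>
      have h : adMonomial (metabelianGen K) 0 (l + 1)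
          ⁅gen K (metabelianGen K) 0, gen K (metabelianGen K) 1⁆ =
          ⁅gen K (metabelianGen K) 1, adMonomial (metabelianGen K) 0 l
            ⁅gen K (metabelianGen K) 0, gen K (metabelianGen K) 1⁆⁆ := by
        rw [adMonomial, pow_succ', Module.End.mul_apply, LieAlgebra.ad_apply]
        rfl
      rw [h, coeff_lie_gen, ih, bracketMonomial_zero_succ]
      split_ifs <;> first | omega | rfl | simp
  | succ k ih =>
    have h : adMonomial (metabelianGen K) (k + 1) l
        ⁅gen K (metabelianGen K) 0, gen K (metabelianGen K) 1⁆ =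
        ⁅gen K (metabelianGen K) 0, adMonomial (metabelianGen K) k l
          ⁅gen K (metabelianGen K) 0, gen K (metabelianGen K) 1⁆⁆ := by
      rw [adMonomial, pow_succ', Module.End.mul_apply, LieAlgebra.ad_apply]
      rfl
    rw [h, coeff_lie_gen, ih, ← lie_zero_bracketMonomial]
    split_ifs <;> first | omega | rfl | simp

/-- The term of degree `n` of `h(ad X, ad Y)[X, Y]`. -/
theorem coeff_adSeries (h : MvPowerSeries (Fin 2) K) (n : ℕ) :
    LieSeries.coeff n (adSeries (metabelianGen K) h
      ⁅gen K (metabelianGen K) 0, gen K (metabelianGen K) 1⁆).1 =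
        if n < 2 then 0 else ∑ p ∈ HasAntidiagonal.antidiagonal (n - 2),
          MvPowerSeries.coeff (Finsupp.single 0 p.1 + Finsupp.single 1 p.2) h •
            bracketMonomial K p.1 p.2 := by
  change ∑ d ∈ range (n + 1), ∑ p ∈ HasAntidiagonal.antidiagonal d,
    MvPowerSeries.coeff (Finsupp.single 0 p.1 + Finsupp.single 1 p.2) h •
      LieSeries.coeff n (adMonomial (metabelianGen K) p.1 p.2
        ⁅gen K (metabelianGen K) 0, gen K (metabelianGen K) 1⁆).1 = _
  simp only [coeff_adMonomial]
  have hz : ∀ d, n ≠ d + 2 → ∑ p ∈ HasAntidiagonal.antidiagonal d,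
      MvPowerSeries.coeff (Finsupp.single 0 p.1 + Finsupp.single 1 p.2) h •
        (if n = p.1 + p.2 + 2 then bracketMonomial K p.1 p.2 else 0) = 0 := by
    intro d hd
    refine sum_eq_zero fun p hp => ?_
    rw [HasAntidiagonal.mem_antidiagonal.1 hp, if_neg hd, smul_zero]
  split_ifs with hn
  · exact sum_eq_zero fun d _ => hz d (by omega)
  -- `[X, Y]` has degree `2`, so degree `n` receives exactly the monomials with `k + l = n - 2`.
  · rw [sum_eq_single (n - 2) (fun d _ hd => hz d (by omega))
      (fun hd => absurd (mem_range.2 (by omega)) hd)]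
    refine sum_congr rfl fun p hp => ?_
    rw [HasAntidiagonal.mem_antidiagonal.1 hp, if_pos (by omega)]

theorem homogeneousComponent_eq_sum (h : MvPowerSeries (Fin 2) K) (n : ℕ) :
    MvPowerSeries.homogeneousComponent n h = ∑ p ∈ HasAntidiagonal.antidiagonal n,
      MvPowerSeries.coeff (Finsupp.single 0 p.1 + Finsupp.single 1 p.2) h •
        (MvPowerSeries.X 0 ^ p.1 * MvPowerSeries.X 1 ^ p.2) := by
  classical
  ext d
  obtain ⟨k, l, rfl⟩ : ∃ k l, d = Finsupp.single 0 k + Finsupp.single 1 l :=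
    ⟨d 0, d 1, by ext i; fin_cases i <;> simp⟩
  rw [MvPowerSeries.coeff_homogeneousComponent, map_sum]
  simp only [X_pow_mul_X_pow, map_smul, smul_eq_mul, MvPowerSeries.coeff_monomial,
    single_add_single_inj, mul_ite, mul_one, mul_zero, map_add, Finsupp.degree_single]
  split_ifs with hn
  · rw [sum_eq_single (k, l)]
    · simp
    · rintro ⟨a, b⟩ _ hne
      rw [if_neg]
      rintro ⟨rfl, rfl⟩
      exact hne rfl
    · intro hkl
      exact absurd (HasAntidiagonal.mem_antidiagonal.2 hn) hkl
  · refine (sum_eq_zero fun p hp => if_neg ?_).symm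
    rintro ⟨rfl, rfl⟩
    exact hn (HasAntidiagonal.mem_antidiagonal.1 hp)

theorem metabelianLinear_coeff_adSeries (h : MvPowerSeries (Fin 2) K) (n : ℕ) :
    metabelianLinear K (LieSeries.coeff n (adSeries (metabelianGen K) h
      ⁅gen K (metabelianGen K) 0, gen K (metabelianGen K) 1⁆).1) = 0 := by
  rw [coeff_adSeries]
  split_ifs
  · exact map_zero _
  · rw [map_sum]
    refine sum_eq_zero fun p _ => ?_
    rw [map_smul, metabelianLinear_bracketMonomial, smul_zero]

theorem metabelianTranslation_coeff_adSeries (h : MvPowerSeries (Fin 2) K) (n : ℕ) :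
    metabelianTranslation K (LieSeries.coeff n (adSeries (metabelianGen K) h
      ⁅gen K (metabelianGen K) 0, gen K (metabelianGen K) 1⁆).1) =
        if n < 2 then 0 else
          -(MvPowerSeries.X 1 * MvPowerSeries.homogeneousComponent (n - 2) h) := by
  rw [coeff_adSeries]
  split_ifs
  · exact map_zero _
  · rw [map_sum, homogeneousComponent_eq_sum, mul_sum, ← sum_neg_distrib]
    refine sum_congr rfl fun p _ => ?_
    rw [map_smul, metabelianTranslation_bracketMonomial, mul_smul_comm, smul_neg, pow_succ]
    congr 2
    ring

theorem freeLieToAssoc_coeff {Z : FreeLieCompletion K} {P : ncSeries K (Fin 2)}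
    (hZ : toNCSeries K Z = P) (n : ℕ) :
    freeLieToAssoc K (Fin 2) (LieSeries.coeff n Z.1) = PowerSeries.coeff n P.1 := by
  rw [← hZ]
  exact (PowerSeries.coeff_mk n fun n => freeLieToAssoc K (Fin 2) (LieSeries.coeff n Z.1)).symm

/-- The Hausdorff series in the free metabelian Lie algebra. -/
theorem toMetabelian_eq [CharZero K] {h : MvPowerSeries (Fin 2) K}
    (hh : MvPowerSeries.X 1 * h * (expQuotient K).subst
        (MvPowerSeries.X 0 + MvPowerSeries.X 1 : MvPowerSeries (Fin 2) K) =
      (expQuotient K).subst (MvPowerSeries.X 0 + MvPowerSeries.X 1 : MvPowerSeries (Fin 2) K) -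
        (expQuotient K).subst (MvPowerSeries.X 0))
    {Z : FreeLieCompletion K} (hZ : toNCSeries K Z = hausdorff K) :
    toMetabelian K Z = gen K (metabelianGen K) 0 + gen K (metabelianGen K) 1 +
      adSeries (metabelianGen K) h
        ⁅gen K (metabelianGen K) 0, gen K (metabelianGen K) 1⁆ := by
  refine Subtype.ext (LieSeries.ext fun n => ?_)
  change metabelianMk K (LieSeries.coeff n Z.1) =
    (if n = 1 then metabelianGen K 0 else 0) + (if n = 1 then metabelianGen K 1 else 0) +
      LieSeries.coeff n (adSeries (metabelianGen K) h
        ⁅gen K (metabelianGen K) 0, gen K (metabelianGen K) 1⁆).1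
  refine eq_of_linear_eq_of_translation_eq K ?_ ?_
  · rw [metabelianLinear_mk, linearPart_apply, freeLieToAssoc_coeff K hZ, ← coeff_entrySeries,
      entrySeries_hausdorff_zero_zero, PowerSeries.coeff_C_mul, map_add, map_add,
      metabelianLinear_coeff_adSeries, PowerSeries.coeff_X]
    split_ifs <;> simp [metabelianLinear_gen]
  · rw [metabelianTranslation_mk, translationPart_apply, freeLieToAssoc_coeff K hZ,
      ← coeff_entrySeries, entrySeries_hausdorff_zero_one K hh, map_add, map_add,
      metabelianTranslation_coeff_adSeries, map_sub, PowerSeries.coeff_C_mul,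
      PowerSeries.coeff_X]
    -- Degree `1` carries the translation `1` of `X`; from degree `2` on, only `-y` times the
    -- component of `h` of degree two less remains.
    rcases n with - | - | n
    · simp
    · simp [metabelianTranslation_gen, PowerSeries.coeff_succ_X_mul]
    · rw [PowerSeries.coeff_succ_X_mul, PowerSeries.coeff_succ_X_mul, coeff_homogenize]
      simp

end Completion

end MetabelianBCH

theorem theorem1p1 (K : Type*) [Field K] [CharZero K] :
    (∃! Z : MetabelianBCH.FreeLieCompletion K,
        MetabelianBCH.toNCSeries K Z = MetabelianBCH.hausdorff K) ∧
      (∃ b : Module.Basis (Fin 2 ⊕ ℕ × ℕ) K (MetabelianBCH.FreeMetabelian K),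
        (∀ i : Fin 2, b (Sum.inl i) = MetabelianBCH.metabelianGen K i) ∧
        ∀ k l : ℕ, b (Sum.inr (k, l)) =
          (LieAlgebra.ad K (MetabelianBCH.FreeMetabelian K) (MetabelianBCH.metabelianGen K 0) ^ k)
            ((LieAlgebra.ad K (MetabelianBCH.FreeMetabelian K)
                (MetabelianBCH.metabelianGen K 1) ^ l)
              ⁅MetabelianBCH.metabelianGen K 0, MetabelianBCH.metabelianGen K 1⁆)) ∧
      ∃ h : MvPowerSeries (Fin 2) K,
        algebraMap (MvPowerSeries (Fin 2) K) (MetabelianBCH.SeriesFractions K) h =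
            MetabelianBCH.metabelianFraction K ∧
          ∀ Z : MetabelianBCH.FreeLieCompletion K,
            MetabelianBCH.toNCSeries K Z = MetabelianBCH.hausdorff K →
              MetabelianBCH.toMetabelian K Z =
                MetabelianBCH.gen K (MetabelianBCH.metabelianGen K) 0 +
                  MetabelianBCH.gen K (MetabelianBCH.metabelianGen K) 1 +
                  MetabelianBCH.adSeries (MetabelianBCH.metabelianGen K) h
                    ⁅MetabelianBCH.gen K (MetabelianBCH.metabelianGen K) 0,
                      MetabelianBCH.gen K (MetabelianBCH.metabelianGen K) 1⁆ := by
  obtain ⟨h, hh⟩ := MetabelianBCH.exists_coefficientFunction K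
  exact ⟨MetabelianBCH.existsUnique_toNCSeries_eq_hausdorff K,
    ⟨MetabelianBCH.metabelianBasis K, fun i => MetabelianBCH.metabelianBasis_apply K (Sum.inl i),
      fun k l => MetabelianBCH.metabelianBasis_apply K (Sum.inr (k, l))⟩,
    h, MetabelianBCH.algebraMap_eq_metabelianFraction K hh,
    fun _ hZ => MetabelianBCH.toMetabelian_eq K hh hZ⟩
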